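/- \textbf{Theorem (classification of Jacobian AC-polynomials).} Let $\Bbbk$ be a field of characteristic zero. An anti-commutative algebra is a $\Bbbk$-linear space with a bilinear bracket satisfying $\{a,b\}=-\{b,a\}$; a generic Poisson algebra (GP-algebra) is a commutative associative unital $\Bbbk$-algebra with a bilinear anti-commutative bracket satisfying $\{a,bc\}=\{a,b\}c+\{a,c\}b$. Let $\operatorname{AC}(X)$ and $\operatorname{GP}(X)$ denote the free anti-commutative algebra and the free GP-algebra over $\Bbbk$ on a set $X$; elements of $\operatorname{AC}(X)$ are regarded as elements of $\operatorname{GP}(X)$ through the canonical map $\operatorname{AC}(X)\to\operatorname{GP}(X)$. Let $X=\{x_1,\dots,x_n\}$. Let $V_i\subseteq \operatorname{AC}(X)$ be the subspace spanned by the non-associative words containing $x_i$ exactly once; an element of $\bigcap_{i=1}^n V_i$ is called polylinear. A polylinear $\Psi$ is called a Jacobian AC-polynomial if for every $i=1,\dots,n$ it is a derivation with respect to $x_i$, i.e. $$\Psi(x_1,\dots,\underset{i}{yz},\dots,x_n)=y\,\Psi(x_1,\dots,\underset{i}{z},\dots,x_n)+z\,\Psi(x_1,\dots,\underset{i}{y},\dots,x_n)$$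 in the free GP-algebra $\operatorname{GP}((X\setminus\{x_i\})\cup\{y,z\})$. Let $\Psi\in\operatorname{AC}(x_1,\dots,x_n)$ be a nonzero Jacobian AC-polynomial. Then either $n=2$ and $\Psi=\alpha\{x_1,x_2\}$ for some $\alpha\in\Bbbk$, $\alpha\neq0$, or $n=3$ and $\Psi=\alpha J_3$ for some $\alpha\in\Bbbk$, $\alpha\ne 0$, where $$J_3=\{\{x_1,x_2\},x_3\}+\{\{x_2,x_3\},x_1\}+\{\{x_3,x_1\},x_2\}.$$ -/

import Mathlib

/-- An anti-commutative algebra over a field `𝕜`: a linear space with a bilinear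
anti-commutative bracket. -/
class ACAlgebra (𝕜 : Type*) (A : Type*) [Field 𝕜] [AddCommGroup A] [Module 𝕜 A] where
  bracket : A →ₗ[𝕜] A →ₗ[𝕜] A
  bracket_anticomm : ∀ a b : A, bracket a b = -bracket b a

/-- The bracket `{a, b}` of an anti-commutative algebra. -/
def br (𝕜 : Type*) {A : Type*} [Field 𝕜] [AddCommGroup A] [Module 𝕜 A] [ACAlgebra 𝕜 A]
    (a b : A) : A :=
  ACAlgebra.bracket (𝕜 := 𝕜) a b

/-- A generic Poisson algebra: a commutative associative unital algebra with an anti-commutative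
bracket satisfying the Leibniz identity. -/
class GPAlgebra (𝕜 : Type*) (A : Type*) [Field 𝕜] [CommRing A] [Algebra 𝕜 A] extends
    ACAlgebra 𝕜 A where
  leibniz : ∀ a b c : A, bracket a (b * c) = bracket a b * c + bracket a c * b

/-! ### The free anti-commutative algebra -/

namespace FreeAC

/-- Formal expressions in the operations of an anti-commutative algebra. -/
inductive Pre (𝕜 X : Type*)
  | of (x : X) : Pre 𝕜 X
  | zero : Pre 𝕜 X
  | add (a b : Pre 𝕜 X) : Pre 𝕜 X
  | smul (c : 𝕜) (a : Pre 𝕜 X) : Pre 𝕜 X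
  | bracket (a b : Pre 𝕜 X) : Pre 𝕜 X

open Pre in
/-- The defining identities of anti-commutative algebras, closed under the operations. -/
inductive Rel (𝕜 X : Type*) [Field 𝕜] : Pre 𝕜 X → Pre 𝕜 X → Prop
  | add_comm (a b) : Rel 𝕜 X (add a b) (add b a)
  | add_assoc (a b c) : Rel 𝕜 X (add (add a b) c) (add a (add b c))
  | zero_add (a) : Rel 𝕜 X (add zero a) a
  | zero_smul (a) : Rel 𝕜 X (smul 0 a) zero
  | one_smul (a) : Rel 𝕜 X (smul 1 a) a
  | mul_smul (c d a) : Rel 𝕜 X (smul (c * d) a) (smul c (smul d a))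
  | add_smul (c d a) : Rel 𝕜 X (smul (c + d) a) (add (smul c a) (smul d a))
  | smul_add (c a b) : Rel 𝕜 X (smul c (add a b)) (add (smul c a) (smul c b))
  | bracket_add_left (a b c) :
      Rel 𝕜 X (bracket (add a b) c) (add (bracket a c) (bracket b c))
  | bracket_smul_left (k a b) : Rel 𝕜 X (bracket (smul k a) b) (smul k (bracket a b))
  | bracket_add_right (a b c) :
      Rel 𝕜 X (bracket a (add b c)) (add (bracket a b) (bracket a c))
  | bracket_smul_right (k a b) : Rel 𝕜 X (bracket a (smul k b)) (smul k (bracket a b))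
  | anticomm (a b) : Rel 𝕜 X (bracket a b) (smul (-1) (bracket b a))
  | add_congr_left {a b} (c) : Rel 𝕜 X a b → Rel 𝕜 X (add a c) (add b c)
  | add_congr_right (c) {a b} : Rel 𝕜 X a b → Rel 𝕜 X (add c a) (add c b)
  | smul_congr (k) {a b} : Rel 𝕜 X a b → Rel 𝕜 X (smul k a) (smul k b)
  | bracket_congr_left {a b} (c) : Rel 𝕜 X a b → Rel 𝕜 X (bracket a c) (bracket b c)
  | bracket_congr_right (c) {a b} : Rel 𝕜 X a b → Rel 𝕜 X (bracket c a) (bracket c b)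

end FreeAC

/-- The free anti-commutative algebra `AC(X)` over `𝕜`. -/
def FreeAC (𝕜 X : Type*) [Field 𝕜] : Type _ := Quot (FreeAC.Rel 𝕜 X)

namespace FreeAC

variable {𝕜 X : Type*} [Field 𝕜]

/-- The element of `AC(X)` represented by a formal expression. -/
def mk (a : Pre 𝕜 X) : FreeAC 𝕜 X := Quot.mk _ a

/-- The generator `x` of `AC(X)`. -/
def of (𝕜 : Type*) [Field 𝕜] {X : Type*} (x : X) : FreeAC 𝕜 X := mk (Pre.of x)

instance : Zero (FreeAC 𝕜 X) := ⟨mk Pre.zero⟩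

instance : Add (FreeAC 𝕜 X) :=
  ⟨Quot.map₂ Pre.add (fun c _ _ h => Rel.add_congr_right c h)
    (fun _ _ c h => Rel.add_congr_left c h)⟩

instance : SMul 𝕜 (FreeAC 𝕜 X) :=
  ⟨fun k => Quot.map (Pre.smul k) (fun _ _ h => Rel.smul_congr k h)⟩

instance : AddCommMonoid (FreeAC 𝕜 X) where
  add_assoc := by rintro ⟨a⟩ ⟨b⟩ ⟨c⟩; exact Quot.sound (Rel.add_assoc a b c)
  zero_add := by rintro ⟨a⟩; exact Quot.sound (Rel.zero_add a)
  add_zero := by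
    rintro ⟨a⟩
    exact (Quot.sound (Rel.add_comm a Pre.zero)).trans (Quot.sound (Rel.zero_add a))
  add_comm := by rintro ⟨a⟩ ⟨b⟩; exact Quot.sound (Rel.add_comm a b)
  nsmul := nsmulRec

instance : Module 𝕜 (FreeAC 𝕜 X) where
  one_smul := by rintro ⟨a⟩; exact Quot.sound (Rel.one_smul a)
  mul_smul := by rintro c d ⟨a⟩; exact Quot.sound (Rel.mul_smul c d a)
  smul_zero := by
    intro c
    have h : (0 : FreeAC 𝕜 X) = (0 : 𝕜) • (0 : FreeAC 𝕜 X) :=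
      (Quot.sound (Rel.zero_smul Pre.zero)).symm
    have h' : c • (0 : 𝕜) • (0 : FreeAC 𝕜 X) = (c * 0) • (0 : FreeAC 𝕜 X) :=
      (Quot.sound (Rel.mul_smul c 0 Pre.zero)).symm
    rw [h, h', mul_zero]
  smul_add := by rintro c ⟨a⟩ ⟨b⟩; exact Quot.sound (Rel.smul_add c a b)
  add_smul := by rintro c d ⟨a⟩; exact Quot.sound (Rel.add_smul c d a)
  zero_smul := by rintro ⟨a⟩; exact Quot.sound (Rel.zero_smul a)

instance : AddCommGroup (FreeAC 𝕜 X) := Module.addCommMonoidToAddCommGroup 𝕜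

instance : ACAlgebra 𝕜 (FreeAC 𝕜 X) where
  bracket := LinearMap.mk₂ 𝕜
    (Quot.map₂ Pre.bracket (fun c _ _ h => Rel.bracket_congr_right c h)
      (fun _ _ c h => Rel.bracket_congr_left c h))
    (by rintro ⟨a⟩ ⟨b⟩ ⟨c⟩; exact Quot.sound (Rel.bracket_add_left a b c))
    (by rintro k ⟨a⟩ ⟨b⟩; exact Quot.sound (Rel.bracket_smul_left k a b))
    (by rintro ⟨a⟩ ⟨b⟩ ⟨c⟩; exact Quot.sound (Rel.bracket_add_right a b c))
    (by rintro k ⟨a⟩ ⟨b⟩; exact Quot.sound (Rel.bracket_smul_right k a b))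
  bracket_anticomm := by
    rintro ⟨a⟩ ⟨b⟩
    rw [← neg_one_smul 𝕜]
    exact Quot.sound (Rel.anticomm a b)

section lift

variable {A : Type*} [AddCommGroup A] [Module 𝕜 A] [ACAlgebra 𝕜 A]

/-- The value of a formal expression in an anti-commutative algebra. -/
def Pre.eval (f : X → A) : Pre 𝕜 X → A
  | .of x => f x
  | .zero => 0
  | .add a b => a.eval f + b.eval f
  | .smul c a => c • a.eval f
  | .bracket a b => br 𝕜 (a.eval f) (b.eval f)

theorem Pre.eval_eq_of_rel (f : X → A) {a b : Pre 𝕜 X} (h : Rel 𝕜 X a b) :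
    a.eval f = b.eval f := by
  induction h with
  | add_comm a b => exact _root_.add_comm _ _
  | add_assoc a b c => exact _root_.add_assoc _ _ _
  | zero_add a => exact _root_.zero_add _
  | zero_smul a => exact _root_.zero_smul _ _
  | one_smul a => exact _root_.one_smul _ _
  | mul_smul c d a => exact (_root_.smul_smul _ _ _).symm
  | add_smul c d a => exact _root_.add_smul _ _ _
  | smul_add c a b => exact _root_.smul_add _ _ _
  | bracket_add_left a b c => simp [Pre.eval, br]
  | bracket_smul_left k a b => simp [Pre.eval, br]
  | bracket_add_right a b c => simp [Pre.eval, br]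
  | bracket_smul_right k a b => simp [Pre.eval, br]
  | anticomm a b =>
    simpa [Pre.eval, br] using ACAlgebra.bracket_anticomm (𝕜 := 𝕜) (a.eval f) (b.eval f)
  | add_congr_left c _ ih => simp [Pre.eval, ih]
  | add_congr_right c _ ih => simp [Pre.eval, ih]
  | smul_congr k _ ih => simp [Pre.eval, ih]
  | bracket_congr_left c _ ih => simp [Pre.eval, ih]
  | bracket_congr_right c _ ih => simp [Pre.eval, ih]

/-- The homomorphism from `AC(X)` to an anti-commutative algebra with prescribed values on the
generators. -/
def lift (f : X → A) : FreeAC 𝕜 X →ₗ[𝕜] A where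
  toFun := Quot.lift (Pre.eval f) (fun _ _ h => Pre.eval_eq_of_rel f h)
  map_add' := by rintro ⟨a⟩ ⟨b⟩; rfl
  map_smul' := by rintro c ⟨a⟩; rfl

theorem lift_of (f : X → A) (x : X) : lift f (of 𝕜 x) = f x := rfl

theorem lift_br (f : X → A) (a b : FreeAC 𝕜 X) :
    lift f (br 𝕜 a b) = br 𝕜 (lift f a) (lift f b) := by
  obtain ⟨a⟩ := a
  obtain ⟨b⟩ := b
  rfl

theorem lift_unique (f : X → A) (g : FreeAC 𝕜 X →ₗ[𝕜] A) (hof : ∀ x, g (of 𝕜 x) = f x)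
    (hbr : ∀ a b, g (br 𝕜 a b) = br 𝕜 (g a) (g b)) : g = lift f := by
  refine LinearMap.ext ?_
  rintro ⟨a⟩
  induction a with
  | of x => exact hof x
  | zero => exact (map_zero g).trans (map_zero (lift f)).symm
  | add a b iha ihb =>
    exact (map_add g (mk a) (mk b)).trans (congrArg₂ _ iha ihb)
  | smul c a ih => exact (map_smul g c (mk a)).trans (congrArg (c • ·) ih)
  | bracket a b iha ihb =>
    exact (hbr (mk a) (mk b)).trans (congrArg₂ (br 𝕜) iha ihb)

end lift

/-- The element of `AC(X)` represented by a non-associative word. -/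
def word (𝕜 : Type*) [Field 𝕜] {X : Type*} : FreeMagma X → FreeAC 𝕜 X
  | .of x => of 𝕜 x
  | .mul u v => br 𝕜 (word 𝕜 u) (word 𝕜 v)

/-- The number of occurrences of the letter `x` in a non-associative word. -/
def letterCount {X : Type*} [DecidableEq X] (x : X) : FreeMagma X → ℕ
  | .of y => if y = x then 1 else 0
  | .mul u v => letterCount x u + letterCount x v

/-- The subspace of `AC(X)` spanned by the non-associative words linear in `x`. -/
def linearIn (𝕜 : Type*) [Field 𝕜] {X : Type*} [DecidableEq X] (x : X) :
    Submodule 𝕜 (FreeAC 𝕜 X) :=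
  Submodule.span 𝕜 (word 𝕜 '' {w | letterCount x w = 1})

/-- The space of polylinear elements of `AC(X)`. -/
def polylinear (𝕜 : Type*) [Field 𝕜] (X : Type*) [DecidableEq X] : Submodule 𝕜 (FreeAC 𝕜 X) :=
  ⨅ x : X, linearIn 𝕜 x

end FreeAC

/-! ### The free generic Poisson algebra -/

namespace FreeGP

/-- Formal expressions in the operations of a generic Poisson algebra. -/
inductive Pre (𝕜 X : Type*)
  | of (x : X) : Pre 𝕜 X
  | scalar (c : 𝕜) : Pre 𝕜 X
  | add (a b : Pre 𝕜 X) : Pre 𝕜 X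
  | mul (a b : Pre 𝕜 X) : Pre 𝕜 X
  | bracket (a b : Pre 𝕜 X) : Pre 𝕜 X

open Pre in
/-- The defining identities of generic Poisson algebras, closed under the operations. The
constants `scalar c` stand for the multiples of the unit, and multiplication by a scalar is
multiplication by the corresponding constant. -/
inductive Rel (𝕜 X : Type*) [Field 𝕜] : Pre 𝕜 X → Pre 𝕜 X → Prop
  | scalar_add (c d : 𝕜) : Rel 𝕜 X (scalar (c + d)) (add (scalar c) (scalar d))
  | scalar_mul (c d : 𝕜) : Rel 𝕜 X (scalar (c * d)) (mul (scalar c) (scalar d))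
  | add_comm (a b) : Rel 𝕜 X (add a b) (add b a)
  | add_assoc (a b c) : Rel 𝕜 X (add (add a b) c) (add a (add b c))
  | zero_add (a) : Rel 𝕜 X (add (scalar 0) a) a
  | zero_mul (a) : Rel 𝕜 X (mul (scalar 0) a) (scalar 0)
  | one_mul (a) : Rel 𝕜 X (mul (scalar 1) a) a
  | mul_comm (a b) : Rel 𝕜 X (mul a b) (mul b a)
  | mul_assoc (a b c) : Rel 𝕜 X (mul (mul a b) c) (mul a (mul b c))
  | mul_add (a b c) : Rel 𝕜 X (mul a (add b c)) (add (mul a b) (mul a c))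
  | bracket_add_left (a b c) :
      Rel 𝕜 X (bracket (add a b) c) (add (bracket a c) (bracket b c))
  | bracket_smul_left (k a b) :
      Rel 𝕜 X (bracket (mul (scalar k) a) b) (mul (scalar k) (bracket a b))
  | bracket_add_right (a b c) :
      Rel 𝕜 X (bracket a (add b c)) (add (bracket a b) (bracket a c))
  | bracket_smul_right (k a b) :
      Rel 𝕜 X (bracket a (mul (scalar k) b)) (mul (scalar k) (bracket a b))
  | anticomm (a b) : Rel 𝕜 X (bracket a b) (mul (scalar (-1)) (bracket b a))
  | leibniz (a b c) :
      Rel 𝕜 X (bracket a (mul b c)) (add (mul (bracket a b) c) (mul (bracket a c) b))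
  | add_congr_left {a b} (c) : Rel 𝕜 X a b → Rel 𝕜 X (add a c) (add b c)
  | add_congr_right (c) {a b} : Rel 𝕜 X a b → Rel 𝕜 X (add c a) (add c b)
  | mul_congr_left {a b} (c) : Rel 𝕜 X a b → Rel 𝕜 X (mul a c) (mul b c)
  | mul_congr_right (c) {a b} : Rel 𝕜 X a b → Rel 𝕜 X (mul c a) (mul c b)
  | bracket_congr_left {a b} (c) : Rel 𝕜 X a b → Rel 𝕜 X (bracket a c) (bracket b c)
  | bracket_congr_right (c) {a b} : Rel 𝕜 X a b → Rel 𝕜 X (bracket c a) (bracket c b)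

end FreeGP

/-- The free generic Poisson algebra `GP(X)` over `𝕜`. -/
def FreeGP (𝕜 X : Type*) [Field 𝕜] : Type _ := Quot (FreeGP.Rel 𝕜 X)

namespace FreeGP

variable {𝕜 X : Type*} [Field 𝕜]

/-- The element of `GP(X)` represented by a formal expression. -/
def mk (a : Pre 𝕜 X) : FreeGP 𝕜 X := Quot.mk _ a

/-- The generator `x` of `GP(X)`. -/
def of (𝕜 : Type*) [Field 𝕜] {X : Type*} (x : X) : FreeGP 𝕜 X := mk (Pre.of x)

instance : Zero (FreeGP 𝕜 X) := ⟨mk (Pre.scalar 0)⟩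

instance : One (FreeGP 𝕜 X) := ⟨mk (Pre.scalar 1)⟩

instance : Add (FreeGP 𝕜 X) :=
  ⟨Quot.map₂ Pre.add (fun c _ _ h => Rel.add_congr_right c h)
    (fun _ _ c h => Rel.add_congr_left c h)⟩

instance : Mul (FreeGP 𝕜 X) :=
  ⟨Quot.map₂ Pre.mul (fun c _ _ h => Rel.mul_congr_right c h)
    (fun _ _ c h => Rel.mul_congr_left c h)⟩

instance : Neg (FreeGP 𝕜 X) := ⟨fun a => mk (Pre.scalar (-1)) * a⟩

theorem mul_comm' (a b : FreeGP 𝕜 X) : a * b = b * a := by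
  obtain ⟨a⟩ := a
  obtain ⟨b⟩ := b
  exact Quot.sound (Rel.mul_comm a b)

theorem add_comm' (a b : FreeGP 𝕜 X) : a + b = b + a := by
  obtain ⟨a⟩ := a
  obtain ⟨b⟩ := b
  exact Quot.sound (Rel.add_comm a b)

theorem zero_add' (a : FreeGP 𝕜 X) : 0 + a = a := by
  obtain ⟨a⟩ := a
  exact Quot.sound (Rel.zero_add a)

theorem zero_mul' (a : FreeGP 𝕜 X) : 0 * a = 0 := by
  obtain ⟨a⟩ := a
  exact Quot.sound (Rel.zero_mul a)

theorem one_mul' (a : FreeGP 𝕜 X) : 1 * a = a := by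
  obtain ⟨a⟩ := a
  exact Quot.sound (Rel.one_mul a)

theorem mul_add' (a b c : FreeGP 𝕜 X) : a * (b + c) = a * b + a * c := by
  obtain ⟨a⟩ := a
  obtain ⟨b⟩ := b
  obtain ⟨c⟩ := c
  exact Quot.sound (Rel.mul_add a b c)

theorem neg_add' (a : FreeGP 𝕜 X) : -a + a = 0 := by
  have h : (mk (Pre.scalar (-1)) : FreeGP 𝕜 X) + 1 = 0 := by
    have h' : (mk (Pre.scalar (-1)) : FreeGP 𝕜 X) + 1 = mk (Pre.scalar (-1 + 1)) :=
      (Quot.sound (Rel.scalar_add (-1 : 𝕜) 1)).symm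
    rw [h', neg_add_cancel]
    rfl
  calc -a + a = mk (Pre.scalar (-1)) * a + 1 * a := by rw [one_mul']; rfl
    _ = 0 := by rw [mul_comm' _ a, mul_comm' 1 a, ← mul_add', h, mul_comm', zero_mul']

instance : CommRing (FreeGP 𝕜 X) where
  add_assoc := by rintro ⟨a⟩ ⟨b⟩ ⟨c⟩; exact Quot.sound (Rel.add_assoc a b c)
  zero_add := zero_add'
  add_zero a := by rw [add_comm', zero_add']
  add_comm := add_comm'
  nsmul := nsmulRec
  zsmul := zsmulRec
  neg_add_cancel := neg_add'
  mul_assoc := by rintro ⟨a⟩ ⟨b⟩ ⟨c⟩; exact Quot.sound (Rel.mul_assoc a b c)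
  mul_comm := mul_comm'
  one_mul := one_mul'
  mul_one a := by rw [mul_comm', one_mul']
  zero_mul := zero_mul'
  mul_zero a := by rw [mul_comm', zero_mul']
  left_distrib := mul_add'
  right_distrib a b c := by rw [mul_comm', mul_add', mul_comm' c a, mul_comm' c b]

/-- The multiples of the unit. -/
def scalarHom (𝕜 X : Type*) [Field 𝕜] : 𝕜 →+* FreeGP 𝕜 X where
  toFun c := mk (Pre.scalar c)
  map_one' := rfl
  map_mul' c d := Quot.sound (Rel.scalar_mul c d)
  map_zero' := rfl
  map_add' c d := Quot.sound (Rel.scalar_add c d)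

instance : Algebra 𝕜 (FreeGP 𝕜 X) := (scalarHom 𝕜 X).toAlgebra

instance : GPAlgebra 𝕜 (FreeGP 𝕜 X) where
  bracket := LinearMap.mk₂ 𝕜
    (Quot.map₂ Pre.bracket (fun c _ _ h => Rel.bracket_congr_right c h)
      (fun _ _ c h => Rel.bracket_congr_left c h))
    (by rintro ⟨a⟩ ⟨b⟩ ⟨c⟩; exact Quot.sound (Rel.bracket_add_left a b c))
    (by
      rintro k ⟨a⟩ ⟨b⟩
      exact Quot.sound (Rel.bracket_smul_left k a b))
    (by rintro ⟨a⟩ ⟨b⟩ ⟨c⟩; exact Quot.sound (Rel.bracket_add_right a b c))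
    (by
      rintro k ⟨a⟩ ⟨b⟩
      exact Quot.sound (Rel.bracket_smul_right k a b))
  bracket_anticomm := by
    rintro ⟨a⟩ ⟨b⟩
    exact Quot.sound (Rel.anticomm a b)
  leibniz := by
    rintro ⟨a⟩ ⟨b⟩ ⟨c⟩
    exact Quot.sound (Rel.leibniz a b c)

section lift

variable {A : Type*} [CommRing A] [Algebra 𝕜 A] [GPAlgebra 𝕜 A]

/-- The value of a formal expression in a generic Poisson algebra. -/
def Pre.eval (f : X → A) : Pre 𝕜 X → A
  | .of x => f x
  | .scalar c => algebraMap 𝕜 A c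
  | .add a b => a.eval f + b.eval f
  | .mul a b => a.eval f * b.eval f
  | .bracket a b => br 𝕜 (a.eval f) (b.eval f)

theorem Pre.eval_eq_of_rel (f : X → A) {a b : Pre 𝕜 X} (h : Rel 𝕜 X a b) :
    a.eval f = b.eval f := by
  induction h with
  | scalar_add c d => exact map_add _ _ _
  | scalar_mul c d => exact map_mul _ _ _
  | add_comm a b => exact _root_.add_comm _ _
  | add_assoc a b c => exact _root_.add_assoc _ _ _
  | zero_add a => simp [Pre.eval]
  | zero_mul a => simp [Pre.eval]
  | one_mul a => simp [Pre.eval]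
  | mul_comm a b => exact _root_.mul_comm _ _
  | mul_assoc a b c => exact _root_.mul_assoc _ _ _
  | mul_add a b c => exact _root_.mul_add _ _ _
  | bracket_add_left a b c => simp [Pre.eval, br]
  | bracket_smul_left k a b => simp [Pre.eval, br, ← Algebra.smul_def]
  | bracket_add_right a b c => simp [Pre.eval, br]
  | bracket_smul_right k a b => simp [Pre.eval, br, ← Algebra.smul_def]
  | anticomm a b =>
    simpa [Pre.eval, br] using ACAlgebra.bracket_anticomm (𝕜 := 𝕜) (a.eval f) (b.eval f)
  | leibniz a b c => exact GPAlgebra.leibniz (𝕜 := 𝕜) _ _ _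
  | add_congr_left c _ ih => simp [Pre.eval, ih]
  | add_congr_right c _ ih => simp [Pre.eval, ih]
  | mul_congr_left c _ ih => simp [Pre.eval, ih]
  | mul_congr_right c _ ih => simp [Pre.eval, ih]
  | bracket_congr_left c _ ih => simp [Pre.eval, ih]
  | bracket_congr_right c _ ih => simp [Pre.eval, ih]

/-- The homomorphism from `GP(X)` to a generic Poisson algebra with prescribed values on the
generators, that is, `Ψ(x₁, x₂, …) ↦ Ψ(f x₁, f x₂, …)`. -/
def lift (f : X → A) : FreeGP 𝕜 X →ₐ[𝕜] A where
  toFun := Quot.lift (Pre.eval f) (fun _ _ h => Pre.eval_eq_of_rel f h)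
  map_one' := map_one (algebraMap 𝕜 A)
  map_mul' := by rintro ⟨a⟩ ⟨b⟩; rfl
  map_zero' := map_zero (algebraMap 𝕜 A)
  map_add' := by rintro ⟨a⟩ ⟨b⟩; rfl
  commutes' _ := rfl

theorem lift_of (f : X → A) (x : X) : lift f (of 𝕜 x) = f x := rfl

theorem lift_br (f : X → A) (a b : FreeGP 𝕜 X) :
    lift f (br 𝕜 a b) = br 𝕜 (lift f a) (lift f b) := by
  obtain ⟨a⟩ := a
  obtain ⟨b⟩ := b
  rfl

theorem lift_unique (f : X → A) (g : FreeGP 𝕜 X →ₐ[𝕜] A) (hof : ∀ x, g (of 𝕜 x) = f x)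
    (hbr : ∀ a b, g (br 𝕜 a b) = br 𝕜 (g a) (g b)) : g = lift f := by
  refine AlgHom.ext ?_
  rintro ⟨a⟩
  induction a with
  | of x => exact hof x
  | scalar c => exact g.commutes c
  | add a b iha ihb =>
    exact (map_add g (mk a) (mk b)).trans (congrArg₂ _ iha ihb)
  | mul a b iha ihb =>
    exact (map_mul g (mk a) (mk b)).trans (congrArg₂ _ iha ihb)
  | bracket a b iha ihb =>
    exact (hbr (mk a) (mk b)).trans (congrArg₂ (br 𝕜) iha ihb)

end lift

end FreeGP

/-! ### Jacobian polynomials -/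

/-- The canonical map `AC(X) → GP(X)`, through which AC-polynomials are regarded as elements of
the free generic Poisson algebra. -/
def FreeAC.toGP {𝕜 X : Type*} [Field 𝕜] : FreeAC 𝕜 X →ₗ[𝕜] FreeGP 𝕜 X :=
  FreeAC.lift (FreeGP.of 𝕜)

namespace FreeGP

variable {𝕜 X : Type*} [Field 𝕜] [DecidableEq X]

/-- The set of variables `(X \ {x}) ∪ {y, z}`. -/
abbrev SplitVars (x : X) : Type _ := {t : X // t ≠ x} ⊕ Bool

/-- The new variable `y`. -/
def varY (𝕜 : Type*) [Field 𝕜] (x : X) : FreeGP 𝕜 (SplitVars x) := of 𝕜 (Sum.inr false)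

/-- The new variable `z`. -/
def varZ (𝕜 : Type*) [Field 𝕜] (x : X) : FreeGP 𝕜 (SplitVars x) := of 𝕜 (Sum.inr true)

/-- Substitution of `p` for the variable `x`, the other variables being left unchanged. -/
def subst (x : X) (p : FreeGP 𝕜 (SplitVars x)) : FreeGP 𝕜 X →ₐ[𝕜] FreeGP 𝕜 (SplitVars x) :=
  lift fun t => if h : t = x then p else of 𝕜 (Sum.inl ⟨t, h⟩)

/-- `Ψ` (assumed linear in `x`) is a derivation with respect to `x`:
`Ψ(…, yz, …) = y Ψ(…, z, …) + z Ψ(…, y, …)` in `GP((X \ {x}) ∪ {y, z})`. -/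
def IsDerivationIn (x : X) (Ψ : FreeGP 𝕜 X) : Prop :=
  subst x (varY 𝕜 x * varZ 𝕜 x) Ψ =
    varY 𝕜 x * subst x (varZ 𝕜 x) Ψ + varZ 𝕜 x * subst x (varY 𝕜 x) Ψ

end FreeGP

/-- A Jacobian AC-polynomial: a polylinear element of `AC(X)` which is a derivation with respect
to every variable. -/
def FreeAC.IsJacobian {𝕜 X : Type*} [Field 𝕜] [DecidableEq X] (Ψ : FreeAC 𝕜 X) : Prop :=
  Ψ ∈ FreeAC.polylinear 𝕜 X ∧ ∀ x : X, FreeGP.IsDerivationIn x (FreeAC.toGP Ψ)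

/-- The Jacobian `{{a, b}, c} + {{b, c}, a} + {{c, a}, b}`. -/
def jacobian (𝕜 : Type*) {A : Type*} [Field 𝕜] [AddCommGroup A] [Module 𝕜 A] [ACAlgebra 𝕜 A]
    (a b c : A) : A :=
  br 𝕜 (br 𝕜 a b) c + br 𝕜 (br 𝕜 b c) a + br 𝕜 (br 𝕜 c a) b

/-! Map AC(X) to the free nonassociative algebra with the commutator bracket and let c(t) be the
coefficient of the binary tree t in the image of Ψ (`FreeAC.treeCoeff`). In characteristic zero
these coefficients determine Ψ (`eq_sum_treeCoeff_smul`). Exchanging the two branches at a node of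
the right spine changes the sign of c (`treeCoeff_spine_swap`), and polylinearity confines c to
trees in which every letter occurs once, so to trees with n leaves.

Write a tree whose rightmost leaf is x as a comb w₁(w₂(⋯(wₖ x))) and regard f(w) = c(`spine w (of
x)`) as a function of words whose letters are trees. To read off the derivation condition in x,
evaluate in a polynomial GP-algebra where trees act freely on two symbols y and z. When yz replaces
x, the Leibniz rule lets each wᵢ fall on y or on z, so the coefficient of (u·y)(v·z) is the sum of f
over the shuffles of u and v. The terms y Ψ(z) and z Ψ(y) only contribute when u or v is empty.
Hence f vanishes on all proper shuffles (`isPrimitive_treeCoeff`), which is Ree's criterion for Lie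
elements.

Such an f satisfies the antipode identity `IsPrimitive.apply_cons_append`, in particular f(u y) =
±f(y u*) with u* the reversal of u. Applied at different end leaves and combined with the sign rule,
it shows that c is antisymmetric in adjacent leaves hanging from the spine. A function both
alternating and primitive vanishes on words of length at least 3, because a signed count of shuffles
is nonzero. A comb carrying a larger subtree reduces, by the antipode identity, to combs with longer
spines. So c = 0 once n ≥ 4 (`FreeMagma.apply_eq_zero`), and the cases n ≤ 3 are computed directly.
-/

/-! ### Shuffles -/

section Shuffle

variable {𝕜 α : Type*} [Field 𝕜]

/-- The sum of the values of `f` over all shuffles of two lists. -/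
def shuffleSum (f : List α → 𝕜) : List α → List α → 𝕜
  | [], v => f v
  | a :: u, [] => f (a :: u)
  | a :: u, b :: v =>
    shuffleSum (fun w => f (a :: w)) u (b :: v) + shuffleSum (fun w => f (b :: w)) (a :: u) v
  termination_by u v => u.length + v.length

@[simp] theorem shuffleSum_nil_left (f : List α → 𝕜) (v : List α) : shuffleSum f [] v = f v := by
  rw [shuffleSum]

@[simp] theorem shuffleSum_nil_right (f : List α → 𝕜) (u : List α) : shuffleSum f u [] = f u := by
  cases u <;> rw [shuffleSum]

theorem shuffleSum_cons_cons (f : List α → 𝕜) (a b : α) (u v : List α) :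
    shuffleSum f (a :: u) (b :: v) =
      shuffleSum (fun w => f (a :: w)) u (b :: v) +
        shuffleSum (fun w => f (b :: w)) (a :: u) v := by
  rw [shuffleSum]

/-- If `f` vanishes on the lists of length `|u| + |v|`, it sums to zero over the shuffles of `u`
and `v`. -/
theorem shuffleSum_eq_zero (f : List α → 𝕜) (u v : List α)
    (hf : ∀ w : List α, w.length = u.length + v.length → f w = 0) : shuffleSum f u v = 0 := by
  induction u generalizing f v with
  | nil => simpa using hf v (by simp)
  | cons a u ihu =>
    induction v generalizing f with
    | nil => simpa using hf (a :: u) (by simp)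
    | cons b v ihv =>
      rw [shuffleSum_cons_cons, ihu, ihv, add_zero]
      · intro w hw
        exact hf _ (by simp only [List.length_cons] at hw ⊢; omega)
      · intro w hw
        exact hf _ (by simp only [List.length_cons] at hw ⊢; omega)

theorem shuffleSum_map {β : Type*} (f : List β → 𝕜) (g : α → β) (u v : List α) :
    shuffleSum f (u.map g) (v.map g) = shuffleSum (fun w => f (w.map g)) u v := by
  induction u generalizing f v with
  | nil => simp
  | cons a u ihu =>
    induction v generalizing f with
    | nil => simp
    | cons b v ihv =>
      simp only [List.map_cons] at ihv ⊢
      rw [shuffleSum_cons_cons, shuffleSum_cons_cons, ← List.map_cons, ihu, ihv]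
      simp

theorem shuffleSum_add (f g : List α → 𝕜) (u v : List α) :
    shuffleSum (fun w => f w + g w) u v = shuffleSum f u v + shuffleSum g u v := by
  induction u generalizing f g v with
  | nil => simp
  | cons a u ihu =>
    induction v generalizing f g with
    | nil => simp
    | cons b v ihv =>
      rw [shuffleSum_cons_cons, ihu, ihv, shuffleSum_cons_cons, shuffleSum_cons_cons]
      ring

theorem shuffleSum_const_mul (k : 𝕜) (f : List α → 𝕜) (u v : List α) :
    shuffleSum (fun w => k * f w) u v = k * shuffleSum f u v := by
  induction u generalizing f v with
  | nil => simp
  | cons a u ihu =>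
    induction v generalizing f with
    | nil => simp
    | cons b v ihv => rw [shuffleSum_cons_cons, ihu, ihv, shuffleSum_cons_cons, mul_add]

/-- The first letter of a shuffle comes from `u` or from `v`. This is the recursion that the Leibniz
rule imposes on coefficients in `combCoeff_br_treePoly`. -/
theorem shuffleSum_of_cons {f g : List α → 𝕜} {k : α → 𝕜} (h0 : f [] = 0)
    (h : ∀ a w, f (a :: w) = k a * g w) (u v : List α) :
    shuffleSum f u v =
      (match u with | [] => 0 | a :: u' => k a * shuffleSum g u' v) +
        (match v with | [] => 0 | b :: v' => k b * shuffleSum g u v') := by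
  cases u <;> cases v <;> simp [h0, h, shuffleSum_cons_cons, shuffleSum_const_mul]

/-- `f` sums to zero over the shuffles of any two nonempty lists, that is, `f` is the coefficient
function of a primitive noncommutative series. -/
def IsPrimitive (f : List α → 𝕜) : Prop :=
  ∀ u v : List α, u ≠ [] → v ≠ [] → shuffleSum f u v = 0

/-- The antipode identity: the letters standing before `y` are moved behind it one at a time, each
at the cost of a sign. -/
theorem IsPrimitive.apply_cons_append {f : List α → 𝕜} (hf : IsPrimitive f) (u v : List α)
    (y : α) : f (u ++ y :: v) =
      (-1) ^ u.length * shuffleSum (fun w => f (y :: w)) u.reverse v := by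
  -- Here `r` collects, in reverse order, the letters already removed from the front.
  have key : ∀ (r : List α) (b : α) (s : List α), u ++ y :: v = b :: s →
      shuffleSum (fun w => f (b :: w)) r s =
        (-1) ^ u.length * shuffleSum (fun w => f (y :: w)) (u.reverse ++ r) v := by
    induction u with
    | nil =>
      intro r b s h
      simp only [List.nil_append, List.cons.injEq] at h
      obtain ⟨rfl, rfl⟩ := h
      simp
    | cons a u ih =>
      intro r b s h
      simp only [List.cons_append, List.cons.injEq] at h
      obtain ⟨rfl, rfl⟩ := h
      obtain ⟨b', s', hs⟩ : ∃ b' s', u ++ y :: v = b' :: s' := by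
        cases u <;> simp
      -- Splitting this vanishing sum by its first letter trades a leading `a` for a leading `b'`,
      -- with a sign.
      have h0 := hf (a :: r) (u ++ y :: v) (by simp) (by simp)
      have h1 := ih (a :: r) b' s' hs
      rw [hs, shuffleSum_cons_cons, h1] at h0
      rw [hs, eq_neg_of_add_eq_zero_left h0]
      simp [pow_succ]
  obtain ⟨b, s, hs⟩ : ∃ b s, u ++ y :: v = b :: s := by cases u <;> simp
  simpa [hs] using key [] b s hs

theorem IsPrimitive.apply_concat {f : List α → 𝕜} (hf : IsPrimitive f) (u : List α) (y : α) :
    f (u ++ [y]) = (-1) ^ u.length * f (y :: u.reverse) := by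
  simpa using hf.apply_cons_append u [] y

/-! ### Alternating primitive functions -/

section Alternating

variable {f : List α → 𝕜}
  (hf : ∀ (u : List α) (a b : α) (v : List α), f (u ++ a :: b :: v) = -f (u ++ b :: a :: v))
include hf

/-- Inserting `b` at depth i contributes (-1)^i, and there are |w| + 1 places. The prefix `p` is
there for the induction. -/
theorem shuffleSum_singleton_of_alternating (p w : List α) (b : α) :
    shuffleSum (fun t => f (p ++ t)) [b] w = (if Even w.length then 1 else 0) * f (p ++ b :: w) := by
  induction w generalizing p with
  | nil => simp
  | cons a w ih =>
    have h := ih (p ++ [a])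
    simp only [List.append_assoc, List.singleton_append] at h
    rw [shuffleSum_cons_cons, shuffleSum_nil_left, h, hf p a b w]
    by_cases hw : Even w.length <;> simp [hw, Nat.even_add_one]

/-- The signed number of shuffles is the Gaussian binomial coefficient (|w| + 2 choose 2) at q = -1.
-/
theorem shuffleSum_pair_of_alternating (p w : List α) (a b : α) :
    shuffleSum (fun t => f (p ++ t)) [a, b] w =
      ((w.length / 2 + 1 : ℕ) : 𝕜) * f (p ++ a :: b :: w) := by
  induction w generalizing p with
  | nil => simp
  | cons x w ih =>
    have h := ih (p ++ [x])
    have h1 := shuffleSum_singleton_of_alternating hf (p ++ [a]) (x :: w) b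
    have h2 : f (p ++ x :: a :: b :: w) = f (p ++ a :: b :: x :: w) := by
      have h3 := hf (p ++ [a]) x b w
      simp only [List.append_assoc, List.singleton_append] at h3
      rw [hf p x a, h3, neg_neg]
    simp only [List.append_assoc, List.singleton_append] at h h1
    rw [shuffleSum_cons_cons, h, h1, h2]
    rcases Nat.even_or_odd' w.length with ⟨m, hm | hm⟩
    · have h3 : ¬ Even (2 * m + 1) := by simp
      have h4 : (2 * m + 1) / 2 = m := by omega
      simp [hm, h3, h4]
    · have h3 : Even (2 * m + 1 + 1) := by simp [Nat.even_add_one]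
      have h4 : (2 * m + 1) / 2 = m := by omega
      have h5 : (2 * m + 1 + 1) / 2 = m + 1 := by omega
      simp only [List.length_cons, hm, h3, h4, h5, if_true]
      push_cast
      ring

theorem IsPrimitive.eq_zero_of_alternating [CharZero 𝕜] (hp : IsPrimitive f) (w : List α)
    (hw : 3 ≤ w.length) : f w = 0 := by
  match w, hw with
  | a :: b :: x :: w, _ =>
    have h := shuffleSum_pair_of_alternating hf [] (x :: w) a b
    simp only [List.nil_append] at h
    rw [hp [a, b] (x :: w) (by simp) (by simp)] at h
    exact (mul_eq_zero.1 h.symm).resolve_left (Nat.cast_ne_zero.2 (Nat.succ_ne_zero _))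

end Alternating

end Shuffle

/-! ### Coefficient functions on binary trees -/

namespace FreeMagma

variable {X : Type*}

/-- The right comb `w₁ * (w₂ * (⋯ * (wₖ * t)))`. -/
def spine (w : List (FreeMagma X)) (t : FreeMagma X) : FreeMagma X := w.foldr (· * ·) t

@[simp] theorem spine_nil (t : FreeMagma X) : spine [] t = t := rfl

@[simp] theorem spine_cons (p : FreeMagma X) (w : List (FreeMagma X)) (t : FreeMagma X) :
    spine (p :: w) t = p * spine w t := rfl

@[simp] theorem spine_append (u v : List (FreeMagma X)) (t : FreeMagma X) :
    spine (u ++ v) t = spine u (spine v t) := by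
  simp [spine]

theorem exists_eq_spine (t : FreeMagma X) : ∃ w z, t = spine w (of z) := by
  induction t with
  | ih1 x => exact ⟨[], x, rfl⟩
  | ih2 p q _ ihq =>
    obtain ⟨w, z, rfl⟩ := ihq
    exact ⟨p :: w, z, rfl⟩

theorem length_lt_length_spine (w : List (FreeMagma X)) (t : FreeMagma X) :
    w.length < (spine w t).length := by
  induction w with
  | nil => exact t.length_pos
  | cons p w ih =>
    have h : (p * spine w t).length = p.length + (spine w t).length := rfl
    have := p.length_pos
    rw [spine_cons, h, List.length_cons]
    omega

theorem length_spine_map_of (w : List X) (z : X) :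
    (spine (w.map of) (of z)).length = w.length + 1 := by
  induction w with
  | nil => rfl
  | cons x w ih =>
    have h : (of x * spine (w.map of) (of z)).length =
      1 + (spine (w.map of) (of z)).length := rfl
    rw [List.map_cons, spine_cons, h, ih, List.length_cons]
    omega

theorem exists_map_of_or_mul (w : List (FreeMagma X)) :
    (∃ l : List X, w = l.map of) ∨ ∃ w₁ p q w₂, w = w₁ ++ (p * q) :: w₂ := by
  induction w with
  | nil => exact Or.inl ⟨[], rfl⟩
  | cons t w ih =>
    induction t with
    | ih2 p q => exact Or.inr ⟨[], p, q, w, rfl⟩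
    | ih1 x =>
      rcases ih with ⟨l, rfl⟩ | ⟨w₁, p, q, w₂, rfl⟩
      · exact Or.inl ⟨x :: l, rfl⟩
      · exact Or.inr ⟨of x :: w₁, p, q, w₂, rfl⟩

/-! ### Vanishing of antisymmetric primitive tree functions in degree at least four -/

section Jacobian

variable {𝕜 : Type*} [Field 𝕜] {c : FreeMagma X → 𝕜}
  (hc : ∀ u p q, c (spine u (p * q)) = -c (spine u (q * p)))
  (hp : ∀ z, IsPrimitive fun w => c (spine w (of z)))

include hc hp

/-- Exchanging branches brings `x`, then `a`, to the end of the spine, where `apply_concat` reverses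
the comb. Both sides reduce in this way to the same value, at `(t * of a) * spine u.reverse (of x)`.
-/
theorem apply_spine_swap (u : List (FreeMagma X)) (a x : X) (t : FreeMagma X) :
    c (spine u (of a * (of x * t))) = -c (spine u (of x * (of a * t))) := by
  have h1 := hc (u ++ [of a]) (of x) t
  have h2 := (hp x).apply_concat (u ++ [of a]) t
  have h3 := hc [t] (of a) (spine u.reverse (of x))
  have h4 := (hp a).apply_concat [t] (spine u.reverse (of x))
  have h5 := hc [] (spine u.reverse (of x)) (t * of a)
  have h6 := (hp x).apply_concat u (t * of a)
  have h7 := hc u (t * of a) (of x)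
  have h8 := hc (u ++ [of x]) t (of a)
  simp only [spine_append, spine_cons, spine_nil, List.reverse_append, List.reverse_cons,
    List.reverse_nil, List.nil_append, List.singleton_append, List.length_append,
    List.length_singleton] at h1 h2 h3 h4 h5 h6 h7 h8
  rw [h1, h2, h3, h4, h5, pow_succ]
  rw [h7, h8, neg_neg] at h6
  linear_combination h6

theorem apply_spine_map_of [CharZero 𝕜] (l : List X) (z : X) (hl : 3 ≤ l.length) :
    c (spine (l.map of) (of z)) = 0 := by
  have hp' : IsPrimitive fun l : List X => c (spine (l.map of) (of z)) := by
    intro u v hu hv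
    rw [← shuffleSum_map (fun w => c (spine w (of z)))]
    exact hp z _ _ (by simpa using hu) (by simpa using hv)
  refine hp'.eq_zero_of_alternating (fun u a b v => ?_) l hl
  simpa using apply_spine_swap hc hp (u.map of) a b (spine (v.map of) (of z))

theorem apply_eq_zero [CharZero 𝕜] {n : ℕ} (hn : 4 ≤ n) (hlen : ∀ t, c t ≠ 0 → t.length = n)
    (t : FreeMagma X) : c t = 0 := by
  -- Descending induction on the spine length: a spine of length at least n has too many leaves.
  have key : ∀ k w z, n ≤ w.length + k → c (spine w (of z)) = 0 := by
    intro k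
    induction k with
    | zero =>
      intro w z hw
      by_contra h
      have h1 := hlen _ h
      have h2 := length_lt_length_spine w (of z)
      omega
    | succ k ih =>
      intro w z hw
      rcases exists_map_of_or_mul w with ⟨l, rfl⟩ | ⟨w₁, p, q, w₂, rfl⟩
      · by_contra h
        have h1 := hlen _ h
        rw [length_spine_map_of] at h1
        exact h (apply_spine_map_of hc hp l z (by omega))
      · obtain ⟨s, a, rfl⟩ := exists_eq_spine q
        have h1 := hc w₁ (p * spine s (of a)) (spine w₂ (of z))
        have h2 := (hp a).apply_cons_append w₁ (p :: s) (spine w₂ (of z))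
        rw [shuffleSum_eq_zero, mul_zero] at h2
        · simp only [spine_append, spine_cons] at h1 h2 ⊢
          rw [h1, h2, neg_zero]
        · intro t ht
          -- Reversing the comb and exchanging `a` with the tail restores the end `z`. The new spine
          -- has |w₁| + |s| + 2 + |w₂| branches, more than the original |w₁| + 1 + |w₂|.
          have h3 := (hp a).apply_concat t.reverse (spine w₂ (of z))
          have h4 := hc t.reverse (spine w₂ (of z)) (of a)
          have h5 := ih (t.reverse ++ of a :: w₂) z (by
            simp only [List.length_append, List.length_reverse, List.length_cons] at hw ht ⊢
            omega)
          simp only [spine_append, spine_cons, spine_nil, List.reverse_reverse] at h3 h4 h5 ⊢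
          rw [h4, h5, neg_zero] at h3
          exact (mul_eq_zero.1 h3.symm).resolve_left (by simp)
  obtain ⟨w, z, rfl⟩ := exists_eq_spine t
  exact key n w z (by omega)

end Jacobian

end FreeMagma

/-! ### The commutator bracket on the free nonassociative algebra -/

open MonoidAlgebra in
theorem FreeMagma.coeff_mul_mul {𝕜 X : Type*} [Field 𝕜] (f g : FreeNonUnitalNonAssocAlgebra 𝕜 X)
    (p q : FreeMagma X) : (f * g).coeff (p * q) = f.coeff p * g.coeff q := by
  classical
  induction f using MonoidAlgebra.induction_linear with
  | zero => simp
  | add f₁ f₂ h₁ h₂ => simp [add_mul, h₁, h₂]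
  | single m r =>
    induction g using MonoidAlgebra.induction_linear with
    | zero => simp
    | add g₁ g₂ h₁ h₂ => simp only [mul_add, coeff_add, Finsupp.add_apply, h₁, h₂]
    | single m' r' =>
      have h : (m * m' = p * q) ↔ m = p ∧ m' = q :=
        ⟨fun h => by injection h with h₁ h₂; exact ⟨h₁, h₂⟩, fun h => by rw [h.1, h.2]⟩
      rw [single_mul_single, coeff_single, coeff_single, coeff_single, Finsupp.single_apply,
        Finsupp.single_apply, Finsupp.single_apply]
      simp only [h]
      by_cases h₁ : m = p <;> by_cases h₂ : m' = q <;> simp [h₁, h₂]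

open MonoidAlgebra in
theorem FreeMagma.coeff_mul_of {𝕜 X : Type*} [Field 𝕜] (f g : FreeNonUnitalNonAssocAlgebra 𝕜 X)
    (x : X) : (f * g).coeff (.of x) = 0 := by
  classical
  induction f using MonoidAlgebra.induction_linear with
  | zero => simp
  | add f₁ f₂ h₁ h₂ => simp [add_mul, h₁, h₂]
  | single m r =>
    exact coeff_single_mul_of_forall_mul_ne r g fun d h => by injection h

noncomputable instance FreeNonUnitalNonAssocAlgebra.instACAlgebra {𝕜 X : Type*} [Field 𝕜] :
    ACAlgebra 𝕜 (FreeNonUnitalNonAssocAlgebra 𝕜 X) where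
  bracket := LinearMap.mul 𝕜 _ - (LinearMap.mul 𝕜 _).flip
  bracket_anticomm a b := by simp

section Bracket

variable {𝕜 A : Type*} [Field 𝕜] [AddCommGroup A] [Module 𝕜 A] [ACAlgebra 𝕜 A]

theorem br_anticomm (a b : A) : br 𝕜 a b = -br 𝕜 b a := ACAlgebra.bracket_anticomm a b

theorem br_add_left (a b c : A) : br 𝕜 (a + b) c = br 𝕜 a c + br 𝕜 b c := by simp [br]

theorem br_add_right (a b c : A) : br 𝕜 a (b + c) = br 𝕜 a b + br 𝕜 a c := by simp [br]

theorem br_smul_left (k : 𝕜) (a b : A) : br 𝕜 (k • a) b = k • br 𝕜 a b := by simp [br]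

theorem br_smul_right (k : 𝕜) (a b : A) : br 𝕜 a (k • b) = k • br 𝕜 a b := by simp [br]

theorem br_zero_left (b : A) : br 𝕜 0 b = 0 := by simp [br]

theorem br_zero_right (a : A) : br 𝕜 a 0 = 0 := by simp [br]

end Bracket

theorem FreeNonUnitalNonAssocAlgebra.br_eq {𝕜 X : Type*} [Field 𝕜]
    (f g : FreeNonUnitalNonAssocAlgebra 𝕜 X) : br 𝕜 f g = f * g - g * f := by
  simp [br, ACAlgebra.bracket]

/-! ### Tree coefficients of AC-polynomials -/

namespace FreeAC

variable {𝕜 X : Type*} [Field 𝕜]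

/-- The homomorphism from the free anti-commutative algebra to the free nonassociative algebra
with the commutator bracket. -/
noncomputable def toCommutator : FreeAC 𝕜 X →ₗ[𝕜] FreeNonUnitalNonAssocAlgebra 𝕜 X :=
  lift fun x => MonoidAlgebra.single (.of x) 1

/-- The coefficient of a binary tree in the commutator expansion of an AC-polynomial. -/
noncomputable def treeCoeff (t : FreeMagma X) : FreeAC 𝕜 X →ₗ[𝕜] 𝕜 where
  toFun Ψ := (toCommutator Ψ).coeff t
  map_add' := by simp
  map_smul' := by simp

theorem treeCoeff_of_of [DecidableEq X] (x y : X) :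
    treeCoeff (.of y) (of 𝕜 x) = if x = y then 1 else 0 := by
  classical
  have h : FreeMagma.of x = FreeMagma.of y ↔ x = y :=
    ⟨fun h => by injection h, fun h => by rw [h]⟩
  change (MonoidAlgebra.single (FreeMagma.of x) (1 : 𝕜)).coeff (.of y) = _
  rw [MonoidAlgebra.coeff_single, Finsupp.single_apply]
  simp only [h]

theorem treeCoeff_mul_of (p q : FreeMagma X) (x : X) :
    treeCoeff (p * q) (of 𝕜 x) = 0 := by
  classical
  change (MonoidAlgebra.single (FreeMagma.of x) (1 : 𝕜)).coeff (p * q) = _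
  rw [MonoidAlgebra.coeff_single, Finsupp.single_apply, if_neg]
  intro h
  injection h

theorem treeCoeff_of_br (x : X) (a b : FreeAC 𝕜 X) : treeCoeff (.of x) (br 𝕜 a b) = 0 := by
  change (toCommutator (br 𝕜 a b)).coeff _ = 0
  rw [toCommutator, lift_br, FreeNonUnitalNonAssocAlgebra.br_eq, MonoidAlgebra.coeff_sub,
    Finsupp.sub_apply, FreeMagma.coeff_mul_of, FreeMagma.coeff_mul_of, sub_zero]

theorem treeCoeff_mul_br (p q : FreeMagma X) (a b : FreeAC 𝕜 X) :
    treeCoeff (p * q) (br 𝕜 a b) =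
      treeCoeff p a * treeCoeff q b - treeCoeff p b * treeCoeff q a := by
  change (toCommutator (br 𝕜 a b)).coeff _ = _
  rw [toCommutator, lift_br, FreeNonUnitalNonAssocAlgebra.br_eq, MonoidAlgebra.coeff_sub,
    Finsupp.sub_apply, FreeMagma.coeff_mul_mul, FreeMagma.coeff_mul_mul]
  rfl

theorem span_range_word : Submodule.span 𝕜 (Set.range (word 𝕜 (X := X))) = ⊤ := by
  have hbr : ∀ a ∈ Submodule.span 𝕜 (Set.range (word 𝕜 (X := X))),
      ∀ b ∈ Submodule.span 𝕜 (Set.range (word 𝕜 (X := X))),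
        br 𝕜 a b ∈ Submodule.span 𝕜 (Set.range (word 𝕜 (X := X))) := by
    intro a ha b hb
    induction ha using Submodule.span_induction with
    | zero => rw [br_zero_left]; exact zero_mem _
    | add a₁ a₂ _ _ h₁ h₂ => rw [br_add_left]; exact add_mem h₁ h₂
    | smul k a _ h => rw [br_smul_left]; exact Submodule.smul_mem _ _ h
    | mem a ha =>
      obtain ⟨p, rfl⟩ := ha
      induction hb using Submodule.span_induction with
      | zero => rw [br_zero_right]; exact zero_mem _
      | add a₁ a₂ _ _ h₁ h₂ => rw [br_add_right]; exact add_mem h₁ h₂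
      | smul k a _ h => rw [br_smul_right]; exact Submodule.smul_mem _ _ h
      | mem b hb =>
        obtain ⟨q, rfl⟩ := hb
        exact Submodule.subset_span ⟨p * q, rfl⟩
  rw [eq_top_iff]
  rintro ⟨a⟩ -
  induction a with
  | of x => exact Submodule.subset_span ⟨.of x, rfl⟩
  | zero => exact zero_mem _
  | add a b iha ihb => exact add_mem iha ihb
  | smul k a ih => exact Submodule.smul_mem _ k ih
  | bracket a b iha ihb => exact hbr _ iha _ ihb

theorem treeCoeff_mul_swap (p q : FreeMagma X) (Ψ : FreeAC 𝕜 X) :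
    treeCoeff (p * q) Ψ = -treeCoeff (q * p) Ψ := by
  have h : Ψ ∈ Submodule.span 𝕜 (Set.range (word 𝕜 (X := X))) := by
    rw [span_range_word]; trivial
  induction h using Submodule.span_induction with
  | zero => simp
  | add a b _ _ ha hb => rw [map_add, map_add, ha, hb, neg_add]
  | smul k a _ h => rw [map_smul, map_smul, h, smul_neg]
  | mem a ha =>
    obtain ⟨t, rfl⟩ := ha
    cases t with
    | of x => exact (treeCoeff_mul_of _ _ x).trans (by rw [word, treeCoeff_mul_of, neg_zero])
    | mul u v => rw [word, treeCoeff_mul_br, treeCoeff_mul_br]; ring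

theorem treeCoeff_spine_swap (u : List (FreeMagma X)) (p q : FreeMagma X) (Ψ : FreeAC 𝕜 X) :
    treeCoeff (.spine u (p * q)) Ψ = -treeCoeff (.spine u (q * p)) Ψ := by
  induction u generalizing Ψ with
  | nil => exact treeCoeff_mul_swap p q Ψ
  | cons a u ih =>
    have h : Ψ ∈ Submodule.span 𝕜 (Set.range (word 𝕜 (X := X))) := by
      rw [span_range_word]; trivial
    induction h using Submodule.span_induction with
    | zero => simp
    | add a b _ _ ha hb => rw [map_add, map_add, ha, hb, neg_add]
    | smul k a _ h => rw [map_smul, map_smul, h, smul_neg]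
    | mem a ha =>
      obtain ⟨t, rfl⟩ := ha
      rw [FreeMagma.spine_cons, FreeMagma.spine_cons]
      cases t with
      | of x => exact (treeCoeff_mul_of _ _ x).trans (by rw [word, treeCoeff_mul_of, neg_zero])
      | mul v w =>
        rw [word, treeCoeff_mul_br, treeCoeff_mul_br, ih, ih (word 𝕜 v)]
        ring

/-! ### Reconstruction of an AC-polynomial from its coefficients -/

/-- The bracketed word of a binary tree with `m` leaves, divided by `2 ^ (m - 1)`. -/
noncomputable def halfWord (𝕜 : Type*) [Field 𝕜] {X : Type*} : FreeMagma X → FreeAC 𝕜 X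
  | .of x => of 𝕜 x
  | .mul p q => (2⁻¹ : 𝕜) • br 𝕜 (halfWord 𝕜 p) (halfWord 𝕜 q)

/-- The left inverse of the commutator expansion. -/
noncomputable def ofCommutator : FreeNonUnitalNonAssocAlgebra 𝕜 X →ₗ[𝕜] FreeAC 𝕜 X where
  toFun f := Finsupp.linearCombination 𝕜 (halfWord 𝕜) f.coeff
  map_add' := by simp
  map_smul' := by simp

theorem ofCommutator_single (m : FreeMagma X) (r : 𝕜) :
    ofCommutator (MonoidAlgebra.single m r) = r • halfWord 𝕜 m := by
  simp [ofCommutator]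

/-- With the factor 1/2, the commutator fg - gf goes to the bracket itself, as its two terms
contribute equally. -/
theorem ofCommutator_mul (f g : FreeNonUnitalNonAssocAlgebra 𝕜 X) :
    ofCommutator (f * g) = (2⁻¹ : 𝕜) • br 𝕜 (ofCommutator f) (ofCommutator g) := by
  induction f using MonoidAlgebra.induction_linear with
  | zero => simp [br_zero_left]
  | add f₁ f₂ h₁ h₂ => simp only [add_mul, map_add, h₁, h₂, br_add_left, smul_add]
  | single m r =>
    induction g using MonoidAlgebra.induction_linear with
    | zero => simp [br_zero_right]
    | add g₁ g₂ h₁ h₂ => simp only [mul_add, map_add, h₁, h₂, br_add_right, smul_add]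
    | single m' r' =>
      have h : halfWord 𝕜 (m * m') = (2⁻¹ : 𝕜) • br 𝕜 (halfWord 𝕜 m) (halfWord 𝕜 m') := rfl
      rw [MonoidAlgebra.single_mul_single, ofCommutator_single, ofCommutator_single,
        ofCommutator_single, br_smul_left, br_smul_right, h]
      simp only [smul_smul]
      congr 1
      ring

theorem ofCommutator_toCommutator [CharZero 𝕜] (Ψ : FreeAC 𝕜 X) :
    ofCommutator (toCommutator Ψ) = Ψ := by
  have h : ofCommutator ∘ₗ toCommutator = (LinearMap.id : FreeAC 𝕜 X →ₗ[𝕜] FreeAC 𝕜 X) := by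
    rw [lift_unique (of 𝕜) LinearMap.id (fun _ => rfl) fun _ _ => rfl]
    refine lift_unique (of 𝕜) _ (fun x => ?_) fun a b => ?_
    · simp [toCommutator, lift_of, ofCommutator, halfWord]
    · simp only [LinearMap.comp_apply]
      have h : toCommutator (br 𝕜 a b) = toCommutator a * toCommutator b -
          toCommutator b * toCommutator a := by
        rw [toCommutator, lift_br, FreeNonUnitalNonAssocAlgebra.br_eq]
      rw [h, map_sub, ofCommutator_mul, ofCommutator_mul,
        br_anticomm (ofCommutator (toCommutator b)), smul_neg, sub_neg_eq_add, ← add_smul]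
      norm_num
  exact LinearMap.congr_fun h Ψ

theorem eq_sum_treeCoeff_smul [CharZero 𝕜] (Ψ : FreeAC 𝕜 X) (s : Finset (FreeMagma X))
    (hs : ∀ t, treeCoeff t Ψ ≠ 0 → t ∈ s) : Ψ = ∑ t ∈ s, treeCoeff t Ψ • halfWord 𝕜 t := by
  conv_lhs => rw [← ofCommutator_toCommutator Ψ]
  exact Finsupp.linearCombination_apply_of_mem_supported 𝕜 (fun t ht =>
    hs t (Finsupp.mem_support_iff.1 ht))

/-! ### Polylinearity -/

section letterCount

variable [DecidableEq X]

theorem letterCount_of (x y : X) :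
    letterCount x (.of y) = if y = x then 1 else 0 := rfl

theorem letterCount_mul (x : X) (p q : FreeMagma X) :
    letterCount x (p * q) = letterCount x p + letterCount x q := rfl

/-- Expanding commutators only exchanges branches, so the multiset of leaves is preserved. -/
theorem letterCount_eq_of_treeCoeff_word_ne_zero (x : X) {t w : FreeMagma X}
    (h : treeCoeff t (word 𝕜 w) ≠ 0) : letterCount x t = letterCount x w := by
  induction w generalizing t with
  | ih1 y =>
    induction t with
    | ih1 z =>
      have h1 : y = z := by
        by_contra hyz
        exact h ((treeCoeff_of_of y z).trans (if_neg hyz))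
      rw [h1]
    | ih2 p q => exact absurd (treeCoeff_mul_of p q y) h
  | ih2 u v ihu ihv =>
    induction t with
    | ih1 z => exact absurd (treeCoeff_of_br z _ _) h
    | ih2 p q =>
      have h1 := treeCoeff_mul_br p q (word 𝕜 u) (word 𝕜 v)
      rw [letterCount_mul, letterCount_mul]
      by_cases h2 : treeCoeff p (word 𝕜 u) * treeCoeff q (word 𝕜 v) = 0
      · have h3 : treeCoeff p (word 𝕜 v) * treeCoeff q (word 𝕜 u) ≠ 0 := by
          intro h3
          exact h (h1.trans (by rw [h2, h3, sub_zero]))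
        rw [ihv (left_ne_zero_of_mul h3), ihu (right_ne_zero_of_mul h3), add_comm]
      · rw [ihu (left_ne_zero_of_mul h2), ihv (right_ne_zero_of_mul h2)]

theorem letterCount_eq_one_of_treeCoeff_ne_zero {x : X} {Ψ : FreeAC 𝕜 X} (hΨ : Ψ ∈ linearIn 𝕜 x)
    {t : FreeMagma X} (h : treeCoeff t Ψ ≠ 0) : letterCount x t = 1 := by
  contrapose! h
  induction hΨ using Submodule.span_induction with
  | zero => simp
  | add a b _ _ ha hb => rw [map_add, ha, hb, add_zero]
  | smul k a _ ha => rw [map_smul, ha, smul_zero]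
  | mem a ha =>
    obtain ⟨w, hw, rfl⟩ := ha
    by_contra h1
    exact h ((letterCount_eq_of_treeCoeff_word_ne_zero x h1).trans hw)

theorem sum_letterCount [Fintype X] (t : FreeMagma X) : ∑ x, letterCount x t = t.length := by
  induction t with
  | ih1 y =>
    simp only [letterCount_of, Finset.sum_ite_eq, Finset.mem_univ, if_true]
    rfl
  | ih2 p q hp hq =>
    simp only [letterCount_mul, Finset.sum_add_distrib, hp, hq]
    rfl

end letterCount

end FreeAC

/-! ### Polynomial generic Poisson algebras -/

namespace MvPolynomial

variable {𝕜 σ : Type*} [Field 𝕜]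

/-- The biderivation of a polynomial algebra with values `β s t` on the pairs of variables, for an
anti-symmetric `β`. -/
noncomputable def biderivation (β : σ → σ → MvPolynomial σ 𝕜) (f : MvPolynomial σ 𝕜) :
    Derivation 𝕜 (MvPolynomial σ 𝕜) (MvPolynomial σ 𝕜) :=
  mkDerivation 𝕜 fun t => -mkDerivation 𝕜 (β t) f

variable (β : σ → σ → MvPolynomial σ 𝕜)

@[simp] theorem biderivation_X (f : MvPolynomial σ 𝕜) (t : σ) :
    biderivation β f (X t) = -mkDerivation 𝕜 (β t) f :=
  mkDerivation_X _ _ _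

theorem biderivation_add (f g : MvPolynomial σ 𝕜) :
    biderivation β (f + g) = biderivation β f + biderivation β g :=
  derivation_ext fun t => by simp [add_comm]

theorem biderivation_smul (k : 𝕜) (f : MvPolynomial σ 𝕜) :
    biderivation β (k • f) = k • biderivation β f :=
  derivation_ext fun t => by simp

theorem biderivation_mul (f g : MvPolynomial σ 𝕜) :
    biderivation β (f * g) = f • biderivation β g + g • biderivation β f :=
  derivation_ext fun t => by simp [add_comm]

/-- For fixed `f` both sides are derivations in `g`, so comparing them on variables is enough. -/
theorem biderivation_anticomm (hβ : ∀ s t, β s t = -β t s) (f g : MvPolynomial σ 𝕜) :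
    biderivation β f g = -biderivation β g f := by
  let L : MvPolynomial σ 𝕜 →ₗ[𝕜] MvPolynomial σ 𝕜 :=
    { toFun := fun g => -biderivation β g f
      map_add' := fun a b => by simp [biderivation_add, add_comm]
      map_smul' := fun k a => by simp [biderivation_smul] }
  let D : Derivation 𝕜 (MvPolynomial σ 𝕜) (MvPolynomial σ 𝕜) := Derivation.mk' L fun a b => by
    simp [L, biderivation_mul, add_comm]
  have h : biderivation β f = D := derivation_ext fun t => by
    have h1 : biderivation β (X t) = mkDerivation 𝕜 (β t) :=
      derivation_ext fun s => by simp [hβ t s]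
    simp [D, L, h1]
  exact congrArg (fun D : Derivation 𝕜 (MvPolynomial σ 𝕜) (MvPolynomial σ 𝕜) => D g) h

/-- The generic Poisson structure on a polynomial algebra with prescribed brackets of the
variables. -/
@[reducible] noncomputable def gpAlgebra (hβ : ∀ s t, β s t = -β t s) :
    GPAlgebra 𝕜 (MvPolynomial σ 𝕜) where
  bracket := LinearMap.mk₂ 𝕜 (fun f g => biderivation β f g)
    (by intros; simp [biderivation_add]) (by intros; simp [biderivation_smul])
    (by intros; simp) (by intros; simp)
  bracket_anticomm := biderivation_anticomm β hβ
  leibniz a b c := by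
    simp only [LinearMap.mk₂_apply, Derivation.leibniz, smul_eq_mul]
    ring

end MvPolynomial

/-- Variables for the free associative module with generators `y` and `z` over the free
nonassociative algebra: the binary trees, and the combs `w₁ (w₂ (⋯ (wₖ y)))` and
`w₁ (w₂ (⋯ (wₖ z)))`. -/
inductive CombVar (X : Type*)
  | tree (w : FreeMagma X) : CombVar X
  | comb (b : Bool) (l : List (FreeMagma X)) : CombVar X

namespace CombVar

open MvPolynomial

variable {𝕜 X : Type*} [Field 𝕜]

/-- The brackets of the variables. -/
noncomputable def structureBracket (𝕜 : Type*) [Field 𝕜] {X : Type*} :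
    CombVar X → CombVar X → MvPolynomial (CombVar X) 𝕜
  | tree p, tree q => MvPolynomial.X (tree (p * q)) - MvPolynomial.X (tree (q * p))
  | tree p, comb b l => MvPolynomial.X (comb b (p :: l))
  | comb b l, tree p => -MvPolynomial.X (comb b (p :: l))
  | comb _ _, comb _ _ => 0

noncomputable instance : GPAlgebra 𝕜 (MvPolynomial (CombVar X) 𝕜) :=
  gpAlgebra (structureBracket 𝕜) (by rintro (_ | _) (_ | _) <;> simp [structureBracket])

theorem br_X_X (s t : CombVar X) :
    br 𝕜 (MvPolynomial.X s : MvPolynomial (CombVar X) 𝕜) (MvPolynomial.X t) =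
      structureBracket 𝕜 s t := by
  change biderivation (structureBracket 𝕜) _ _ = _
  rw [biderivation_X, mkDerivation_X]
  rcases s with _ | _ <;> rcases t with _ | _ <;> simp [structureBracket]

/-- The linear polynomial corresponding to an element of the free nonassociative algebra. -/
noncomputable def treePoly : FreeNonUnitalNonAssocAlgebra 𝕜 X →ₗ[𝕜] MvPolynomial (CombVar X) 𝕜 where
  toFun f := Finsupp.linearCombination 𝕜 (fun w => MvPolynomial.X (tree w)) f.coeff
  map_add' := by simp
  map_smul' := by simp

theorem treePoly_single (m : FreeMagma X) (r : 𝕜) :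
    treePoly (MonoidAlgebra.single m r) = r • MvPolynomial.X (tree m) := by
  simp [treePoly]

theorem treePoly_br (f g : FreeNonUnitalNonAssocAlgebra 𝕜 X) :
    treePoly (br 𝕜 f g) = br 𝕜 (treePoly f) (treePoly g) := by
  induction f using MonoidAlgebra.induction_linear with
  | zero => simp [br_zero_left]
  | add f₁ f₂ h₁ h₂ => simp only [map_add, h₁, h₂, br_add_left]
  | single m r =>
    induction g using MonoidAlgebra.induction_linear with
    | zero => simp [br_zero_right]
    | add g₁ g₂ h₁ h₂ => simp only [map_add, h₁, h₂, br_add_right]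
    | single m' r' =>
      rw [FreeNonUnitalNonAssocAlgebra.br_eq, MonoidAlgebra.single_mul_single,
        MonoidAlgebra.single_mul_single, map_sub]
      simp only [treePoly_single]
      rw [br_smul_left, br_smul_right, br_X_X, structureBracket, smul_sub, smul_sub, smul_smul,
        smul_smul, mul_comm r']

/-- The product of two combs, with ends `y` and `z`. -/
noncomputable def combProd (𝕜 : Type*) [Field 𝕜] {X : Type*}
    (d : List (FreeMagma X) × List (FreeMagma X)) : MvPolynomial (CombVar X) 𝕜 :=
  MvPolynomial.X (comb false d.1) * MvPolynomial.X (comb true d.2)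

theorem br_tree_combProd (p : FreeMagma X) (u v : List (FreeMagma X)) :
    br 𝕜 (MvPolynomial.X (tree p)) (combProd 𝕜 (u, v)) =
      combProd 𝕜 (p :: u, v) + combProd 𝕜 (u, p :: v) := by
  have h := GPAlgebra.leibniz (𝕜 := 𝕜) (MvPolynomial.X (tree p) : MvPolynomial (CombVar X) 𝕜)
    (MvPolynomial.X (comb false u)) (MvPolynomial.X (comb true v))
  refine h.trans ?_
  change br 𝕜 _ _ * _ + br 𝕜 _ _ * _ = _
  rw [br_X_X, br_X_X]
  simp only [combProd, structureBracket]
  ring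

/-- The coefficient of a product of two combs, with ends `y` and `z`, in a polynomial. -/
noncomputable def combCoeff (u v : List (FreeMagma X)) : MvPolynomial (CombVar X) 𝕜 →ₗ[𝕜] 𝕜 :=
  MvPolynomial.lcoeff 𝕜 (Finsupp.single (comb false u) 1 + Finsupp.single (comb true v) 1)

theorem combProd_eq_monomial (u v : List (FreeMagma X)) :
    combProd 𝕜 (u, v) =
      monomial (Finsupp.single (comb false u) 1 + Finsupp.single (comb true v) 1) 1 := by
  simp [combProd, MvPolynomial.X, monomial_mul]

theorem combCoeff_combProd [DecidableEq X] (u v u' v' : List (FreeMagma X)) :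
    combCoeff u v (combProd 𝕜 (u', v')) = if u = u' ∧ v = v' then 1 else 0 := by
  classical
  rw [combProd_eq_monomial, combCoeff, lcoeff_apply, coeff_monomial]
  congr 1
  rw [Finsupp.single_add_single_eq_single_add_single one_ne_zero one_ne_zero]
  simp
  constructor <;> rintro ⟨rfl, rfl⟩ <;> simp

/-- The span of the products of two combs with ends `y` and `z`. -/
noncomputable def combSpan (𝕜 X : Type*) [Field 𝕜] :
    Submodule 𝕜 (MvPolynomial (CombVar X) 𝕜) :=
  Submodule.span 𝕜 (Set.range (combProd 𝕜))

theorem br_treePoly_mem_combSpan (f : FreeNonUnitalNonAssocAlgebra 𝕜 X)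
    {g : MvPolynomial (CombVar X) 𝕜} (hg : g ∈ combSpan 𝕜 X) :
    br 𝕜 (treePoly f) g ∈ combSpan 𝕜 X := by
  induction f using MonoidAlgebra.induction_linear with
  | zero => rw [map_zero, br_zero_left]; exact zero_mem _
  | add f₁ f₂ h₁ h₂ => rw [map_add, br_add_left]; exact add_mem h₁ h₂
  | single m r =>
    rw [treePoly_single, br_smul_left]
    refine Submodule.smul_mem _ _ ?_
    induction hg using Submodule.span_induction with
    | zero => rw [br_zero_right]; exact zero_mem _
    | add a b _ _ ha hb => rw [br_add_right]; exact add_mem ha hb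
    | smul k a _ ha => rw [br_smul_right]; exact Submodule.smul_mem _ _ ha
    | mem a ha =>
      obtain ⟨⟨u, v⟩, rfl⟩ := ha
      rw [br_tree_combProd]
      exact add_mem (Submodule.subset_span ⟨_, rfl⟩) (Submodule.subset_span ⟨_, rfl⟩)

/-- The coefficients of `{f, g}`, in terms of those of `f` and `g`. -/
theorem combCoeff_br_treePoly (f : FreeNonUnitalNonAssocAlgebra 𝕜 X)
    {g : MvPolynomial (CombVar X) 𝕜} (hg : g ∈ combSpan 𝕜 X) (u v : List (FreeMagma X)) :
    combCoeff u v (br 𝕜 (treePoly f) g) =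
      (match u with | [] => 0 | a :: u' => f.coeff a * combCoeff u' v g) +
        (match v with | [] => 0 | b :: v' => f.coeff b * combCoeff u v' g) := by
  classical
  induction f using MonoidAlgebra.induction_linear with
  | zero => rw [map_zero, br_zero_left]; cases u <;> cases v <;> simp
  | add f₁ f₂ h₁ h₂ =>
    rw [map_add, br_add_left, map_add, h₁, h₂]
    cases u <;> cases v <;> simp <;> ring
  | single m r =>
    rw [treePoly_single, br_smul_left, map_smul]
    induction hg using Submodule.span_induction with
    | zero => rw [br_zero_right]; cases u <;> cases v <;> simp
    | add a b _ _ ha hb =>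
      rw [br_add_right, map_add, smul_add, ha, hb]
      cases u <;> cases v <;> simp <;> ring
    | smul k a _ ha =>
      rw [br_smul_right, map_smul, smul_comm, ha]
      cases u <;> cases v <;> simp <;> ring
    | mem a ha =>
      obtain ⟨⟨u₀, v₀⟩, rfl⟩ := ha
      rw [br_tree_combProd, map_add, combCoeff_combProd, combCoeff_combProd]
      simp only [combCoeff_combProd, MonoidAlgebra.coeff_single, Finsupp.single_apply]
      cases u with
      | nil =>
        cases v with
        | nil => simp
        | cons b v => by_cases h : m = b <;> simp [h, eq_comm]
      | cons a u =>
        cases v with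
        | nil => by_cases h : m = a <;> simp [h, eq_comm]
        | cons b v =>
          by_cases h : m = a <;> by_cases h' : m = b <;> simp [h, h', mul_add] <;>
            grind

end CombVar

/-! ### Jacobian polynomials have primitive coefficient functions -/

namespace FreeAC

open CombVar

variable {𝕜 X : Type*} [Field 𝕜] [DecidableEq X]

/-- The value of an AC-polynomial in the polynomial generic Poisson algebra when `p` is substituted
for `x`. -/
noncomputable def evalAt (x : X) (p : MvPolynomial (CombVar X) 𝕜) :
    FreeAC 𝕜 X →ₗ[𝕜] MvPolynomial (CombVar X) 𝕜 :=
  lift fun t => if t = x then p else MvPolynomial.X (tree (.of t))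

theorem evalAt_br (x : X) (p : MvPolynomial (CombVar X) 𝕜) (a b : FreeAC 𝕜 X) :
    evalAt x p (br 𝕜 a b) = br 𝕜 (evalAt x p a) (evalAt x p b) :=
  lift_br _ a b

theorem evalAt_of_self (x : X) (p : MvPolynomial (CombVar X) 𝕜) :
    evalAt x p (of 𝕜 x) = p := by
  rw [evalAt, lift_of, if_pos rfl]

theorem evalAt_word_of_letterCount_eq_zero {x : X} (p : MvPolynomial (CombVar X) 𝕜)
    {w : FreeMagma X} (hw : letterCount x w = 0) :
    evalAt x p (word 𝕜 w) = treePoly (toCommutator (word 𝕜 w)) := by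
  induction w with
  | ih1 y =>
    have h : y ≠ x := by
      rintro rfl
      simp [letterCount_of] at hw
    rw [word, evalAt, lift_of, if_neg h, toCommutator, lift_of, treePoly_single, one_smul]
  | ih2 u v hu hv =>
    rw [letterCount_mul, Nat.add_eq_zero_iff] at hw
    have h : word 𝕜 (u * v) = br 𝕜 (word 𝕜 u) (word 𝕜 v) := rfl
    rw [h, evalAt_br, hu hw.1, hv hw.2, ← treePoly_br, toCommutator, lift_br]

/-- Induction principle: up to sign, a word linear in `x` is `x` or a bracket whose left factor
avoids `x` and whose right factor is linear in `x`. -/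
theorem linearIn_le {x : X} {S : Submodule 𝕜 (FreeAC 𝕜 X)} (hx : of 𝕜 x ∈ S)
    (hbr : ∀ w, letterCount x w = 0 → ∀ b ∈ S, br 𝕜 (word 𝕜 w) b ∈ S) : linearIn 𝕜 x ≤ S := by
  refine Submodule.span_le.2 ?_
  rintro _ ⟨w, hw, rfl⟩
  change letterCount x w = 1 at hw
  change word 𝕜 w ∈ S
  induction w with
  | ih1 y =>
    rw [letterCount_of] at hw
    have h : y = x := by
      by_contra h
      simp [h] at hw
    rwa [h]
  | ih2 u v hu hv =>
    rw [letterCount_mul] at hw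
    have h : word 𝕜 (u * v) = br 𝕜 (word 𝕜 u) (word 𝕜 v) := rfl
    rw [h]
    rcases Nat.eq_zero_or_pos (letterCount x u) with h0 | h0
    · exact hbr u h0 _ (hv (by omega))
    · rw [br_anticomm]
      exact neg_mem (hbr v (by omega) _ (hu (by omega)))

theorem evalAt_comb_mem {x : X} (b : Bool) {Ψ : FreeAC 𝕜 X} (hΨ : Ψ ∈ linearIn 𝕜 x) :
    evalAt x (MvPolynomial.X (comb b [])) Ψ ∈
      Submodule.span 𝕜 (Set.range fun l => (MvPolynomial.X (comb b l) :
        MvPolynomial (CombVar X) 𝕜)) := by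
  refine linearIn_le (S := Submodule.comap (evalAt x (MvPolynomial.X (comb b [])))
    (Submodule.span 𝕜 (Set.range fun l => MvPolynomial.X (comb b l)))) ?_ ?_ hΨ
  · rw [Submodule.mem_comap, evalAt_of_self]
    exact Submodule.subset_span ⟨[], rfl⟩
  · intro w hw g hg
    rw [Submodule.mem_comap] at hg ⊢
    rw [evalAt_br, evalAt_word_of_letterCount_eq_zero _ hw]
    generalize toCommutator (word 𝕜 w) = f
    generalize evalAt x (MvPolynomial.X (comb b [])) g = G at hg
    induction f using MonoidAlgebra.induction_linear with
    | zero => rw [map_zero, br_zero_left]; exact zero_mem _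
    | add f₁ f₂ h₁ h₂ => rw [map_add, br_add_left]; exact add_mem h₁ h₂
    | single m r =>
      rw [treePoly_single, br_smul_left]
      refine Submodule.smul_mem _ _ ?_
      induction hg using Submodule.span_induction with
      | zero => rw [br_zero_right]; exact zero_mem _
      | add a b _ _ ha hb => rw [br_add_right]; exact add_mem ha hb
      | smul k a _ ha => rw [br_smul_right]; exact Submodule.smul_mem _ _ ha
      | mem a ha =>
        obtain ⟨l, rfl⟩ := ha
        rw [br_X_X]
        exact Submodule.subset_span ⟨m :: l, rfl⟩

/-- Bracketing with an `x`-free word prepends a tree to one of the two combs, which is how a shuffle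
is built from its first letter. Membership in `combSpan` is carried along because the coefficient
recursion needs it. -/
theorem evalAt_combProd {x : X} {Ψ : FreeAC 𝕜 X} (hΨ : Ψ ∈ linearIn 𝕜 x) :
    evalAt x (combProd 𝕜 ([], [])) Ψ ∈ combSpan 𝕜 X ∧
      ∀ u v, combCoeff u v (evalAt x (combProd 𝕜 ([], [])) Ψ) =
        shuffleSum (fun w => treeCoeff (.spine w (.of x)) Ψ) u v := by
  let S : Submodule 𝕜 (FreeAC 𝕜 X) :=
    { carrier := {Ψ | evalAt x (combProd 𝕜 ([], [])) Ψ ∈ combSpan 𝕜 X ∧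
        ∀ u v, combCoeff u v (evalAt x (combProd 𝕜 ([], [])) Ψ) =
          shuffleSum (fun w => treeCoeff (.spine w (.of x)) Ψ) u v}
      zero_mem' := by
        refine ⟨by rw [map_zero]; exact zero_mem _, fun u v => ?_⟩
        rw [shuffleSum_eq_zero _ _ _ fun _ _ => map_zero _]
        simp
      add_mem' := by
        rintro a b ⟨ha, ha'⟩ ⟨hb, hb'⟩
        refine ⟨by rw [map_add]; exact add_mem ha hb, fun u v => ?_⟩
        simp only [map_add, shuffleSum_add, ha', hb']
      smul_mem' := by
        rintro k a ⟨ha, ha'⟩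
        refine ⟨by rw [map_smul]; exact Submodule.smul_mem _ k ha, fun u v => ?_⟩
        simp only [map_smul, smul_eq_mul, shuffleSum_const_mul, ha'] }
  refine linearIn_le (S := S) ⟨?_, fun u v => ?_⟩ ?_ hΨ
  · rw [evalAt_of_self]
    exact Submodule.subset_span ⟨_, rfl⟩
  · rw [evalAt_of_self, combCoeff_combProd]
    by_cases huv : u = [] ∧ v = []
    · rw [if_pos huv, huv.1, huv.2]
      simp [treeCoeff_of_of]
    · rw [if_neg huv, shuffleSum_eq_zero]
      intro w hw
      match w with
      | [] =>
        simp only [List.length_nil] at hw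
        exact absurd ⟨List.length_eq_zero_iff.1 (by omega), List.length_eq_zero_iff.1 (by omega)⟩
          huv
      | a :: w => exact treeCoeff_mul_of _ _ _
  · rintro p hp b ⟨hb, hb'⟩
    -- An `x`-free word has no tree ending in `x`, which kills the second term of the commutator.
    have h0 : ∀ w, treeCoeff (.spine w (.of x)) (word 𝕜 p) = 0 := by
      intro w
      by_contra h
      have h1 := letterCount_eq_of_treeCoeff_word_ne_zero x h
      have h2 : 0 < letterCount x (.spine w (.of x)) := by
        clear h h1
        induction w with
        | nil => simp [letterCount_of]
        | cons a w ih => rw [FreeMagma.spine_cons, letterCount_mul]; omega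
      omega
    refine ⟨?_, fun u v => ?_⟩
    · rw [evalAt_br, evalAt_word_of_letterCount_eq_zero _ hp]
      exact br_treePoly_mem_combSpan _ hb
    · rw [evalAt_br, evalAt_word_of_letterCount_eq_zero _ hp, combCoeff_br_treePoly _ hb,
        shuffleSum_of_cons (g := fun w => treeCoeff (.spine w (.of x)) b)
          (k := fun a => treeCoeff a (word 𝕜 p))]
      · simp only [hb']
        cases u <;> cases v <;> rfl
      · exact treeCoeff_of_br x _ _
      · intro a w
        rw [FreeMagma.spine_cons, treeCoeff_mul_br, h0, mul_zero, sub_zero]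

/-- The identity in the free GP-algebra is transported along the homomorphism sending y and z to the
empty combs. -/
theorem evalAt_mul_of_isDerivationIn {x : X} {Ψ : FreeAC 𝕜 X}
    (h : FreeGP.IsDerivationIn x (toGP Ψ)) :
    evalAt x (combProd 𝕜 ([], [])) Ψ =
      MvPolynomial.X (comb false []) * evalAt x (MvPolynomial.X (comb true [])) Ψ +
        MvPolynomial.X (comb true []) * evalAt x (MvPolynomial.X (comb false [])) Ψ := by
  let φ : FreeGP 𝕜 (FreeGP.SplitVars x) →ₐ[𝕜] MvPolynomial (CombVar X) 𝕜 :=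
    FreeGP.lift (Sum.elim (fun t => MvPolynomial.X (tree (.of t.1)))
      fun b => MvPolynomial.X (comb b []))
  have hφ : ∀ p, φ (FreeGP.subst x p (toGP Ψ)) = evalAt x (φ p) Ψ := by
    intro p
    refine LinearMap.congr_fun (f := φ.toLinearMap ∘ₗ (FreeGP.subst x p).toLinearMap ∘ₗ toGP)
      (lift_unique _ _ (fun t => ?_) fun a b => ?_) Ψ
    · change φ (FreeGP.subst x p (FreeGP.of 𝕜 t)) = _
      rw [FreeGP.subst, FreeGP.lift_of]
      split_ifs <;> rfl
    · change φ (FreeGP.subst x p (toGP (br 𝕜 a b))) = _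
      rw [toGP, lift_br, FreeGP.subst, FreeGP.lift_br, FreeGP.lift_br]
      rfl
  have h1 := congrArg φ h
  rw [map_add, map_mul, map_mul, hφ, hφ, hφ, map_mul] at h1
  exact h1

theorem isPrimitive_treeCoeff {x : X} {Ψ : FreeAC 𝕜 X} (hΨ : Ψ ∈ linearIn 𝕜 x)
    (h : FreeGP.IsDerivationIn x (toGP Ψ)) :
    IsPrimitive fun w => treeCoeff (.spine w (.of x)) Ψ := by
  intro u v hu hv
  rw [← (evalAt_combProd hΨ).2, evalAt_mul_of_isDerivationIn h, map_add]
  have h1 := evalAt_comb_mem true hΨ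
  have h2 := evalAt_comb_mem false hΨ
  generalize evalAt x (MvPolynomial.X (comb true [])) Ψ = f at h1
  generalize evalAt x (MvPolynomial.X (comb false [])) Ψ = g at h2
  have h3 : combCoeff u v (MvPolynomial.X (comb false []) * f) = 0 := by
    induction h1 using Submodule.span_induction with
    | zero => simp
    | add a b _ _ ha hb => rw [mul_add, map_add, ha, hb, add_zero]
    | smul k a _ ha => rw [mul_smul_comm, map_smul, ha, smul_zero]
    | mem a ha =>
      obtain ⟨l, rfl⟩ := ha
      exact (combCoeff_combProd u v [] l).trans (if_neg fun h => hu h.1)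
  have h4 : combCoeff u v (MvPolynomial.X (comb true []) * g) = 0 := by
    induction h2 using Submodule.span_induction with
    | zero => simp
    | add a b _ _ ha hb => rw [mul_add, map_add, ha, hb, add_zero]
    | smul k a _ ha => rw [mul_smul_comm, map_smul, ha, smul_zero]
    | mem a ha =>
      obtain ⟨l, rfl⟩ := ha
      rw [mul_comm]
      exact (combCoeff_combProd u v l []).trans (if_neg fun h => hv h.2)
  rw [h3, h4, add_zero]

end FreeAC

/-! ### Small numbers of variables -/

namespace FreeAC

variable {𝕜 : Type*} [Field 𝕜]

theorem IsJacobian.mem_linearIn {X : Type*} [DecidableEq X] {Ψ : FreeAC 𝕜 X} (h : IsJacobian Ψ)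
    (x : X) : Ψ ∈ linearIn 𝕜 x :=
  (Submodule.mem_iInf _).1 h.1 x

theorem IsJacobian.letterCount_eq_one {X : Type*} [DecidableEq X] {Ψ : FreeAC 𝕜 X}
    (h : IsJacobian Ψ) {t : FreeMagma X} (ht : treeCoeff t Ψ ≠ 0) (x : X) : letterCount x t = 1 :=
  letterCount_eq_one_of_treeCoeff_ne_zero (h.mem_linearIn x) ht

theorem IsJacobian.length_eq_card {X : Type*} [DecidableEq X] [Fintype X] {Ψ : FreeAC 𝕜 X}
    (h : IsJacobian Ψ) {t : FreeMagma X} (ht : treeCoeff t Ψ ≠ 0) : t.length = Fintype.card X := by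
  simp [← sum_letterCount, h.letterCount_eq_one ht]

theorem IsJacobian.isPrimitive {X : Type*} [DecidableEq X] {Ψ : FreeAC 𝕜 X}
    (h : IsJacobian Ψ) (x : X) : IsPrimitive fun w => treeCoeff (.spine w (.of x)) Ψ :=
  isPrimitive_treeCoeff (h.mem_linearIn x) (h.2 x)

end FreeAC

/-! ### Trees with at most three leaves -/

namespace FreeMagma

variable {X : Type*}

theorem exists_of_length_eq_one {t : FreeMagma X} (ht : t.length = 1) : ∃ x, t = of x := by
  cases t with
  | of x => exact ⟨x, rfl⟩
  | mul p q =>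
    have h : p.length + q.length = 1 := ht
    have := p.length_pos
    have := q.length_pos
    omega

theorem exists_of_length_eq_two {t : FreeMagma X} (ht : t.length = 2) :
    ∃ x y, t = of x * of y := by
  cases t with
  | of x => exact absurd (show 1 = 2 from ht) (by norm_num)
  | mul p q =>
    have h : p.length + q.length = 2 := ht
    have h1 := p.length_pos
    have h2 := q.length_pos
    obtain ⟨x, rfl⟩ := exists_of_length_eq_one (t := p) (by omega)
    obtain ⟨y, rfl⟩ := exists_of_length_eq_one (t := q) (by omega)
    exact ⟨x, y, rfl⟩

theorem exists_of_length_eq_three {t : FreeMagma X} (ht : t.length = 3) :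
    ∃ x y z, t = of x * (of y * of z) ∨ t = (of x * of y) * of z := by
  cases t with
  | of x => exact absurd (show 1 = 3 from ht) (by norm_num)
  | mul p q =>
    have h : p.length + q.length = 3 := ht
    have h1 := p.length_pos
    have h2 := q.length_pos
    rcases (show p.length = 1 ∧ q.length = 2 ∨ p.length = 2 ∧ q.length = 1 by omega) with
      ⟨hp, hq⟩ | ⟨hp, hq⟩
    · obtain ⟨x, rfl⟩ := exists_of_length_eq_one hp
      obtain ⟨y, z, rfl⟩ := exists_of_length_eq_two hq
      exact ⟨x, y, z, Or.inl rfl⟩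
    · obtain ⟨x, y, rfl⟩ := exists_of_length_eq_two hp
      obtain ⟨z, rfl⟩ := exists_of_length_eq_one hq
      exact ⟨x, y, z, Or.inr rfl⟩

end FreeMagma

namespace FreeAC

open CombVar

variable {𝕜 : Type*} [Field 𝕜] [CharZero 𝕜]

theorem IsJacobian.eq_zero_of_one {Ψ : FreeAC 𝕜 (Fin 1)} (hJ : IsJacobian Ψ) : Ψ = 0 := by
  have h := eq_sum_treeCoeff_smul Ψ {FreeMagma.of 0} fun t ht => by
    obtain ⟨x, rfl⟩ := FreeMagma.exists_of_length_eq_one (hJ.length_eq_card ht)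
    rw [Subsingleton.elim x 0]
    exact Finset.mem_singleton_self _
  rw [Finset.sum_singleton] at h
  generalize treeCoeff (FreeMagma.of 0) Ψ = k at h
  have h1 := evalAt_mul_of_isDerivationIn (hJ.2 0)
  have h2 : ∀ p, evalAt 0 p Ψ = k • p := fun p => by
    rw [h, map_smul, halfWord, evalAt_of_self]
  rw [h2, h2, h2] at h1
  have h3 := congrArg (combCoeff [] []) h1
  have h4 : (MvPolynomial.X (comb false []) * MvPolynomial.X (comb true []) :
      MvPolynomial (CombVar (Fin 1)) 𝕜) = combProd 𝕜 ([], []) := rfl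
  rw [mul_smul_comm, mul_smul_comm, mul_comm (MvPolynomial.X (comb true [])), h4, map_add,
    map_smul, combCoeff_combProd] at h3
  -- Comparing coefficients of yz gives k = k + k.
  have h5 : k = 0 := by simpa using h3
  rw [h, h5, zero_smul]

theorem IsJacobian.eq_smul_br {Ψ : FreeAC 𝕜 (Fin 2)} (hJ : IsJacobian Ψ) :
    Ψ = treeCoeff (.of 0 * .of 1) Ψ • br 𝕜 (FreeAC.of 𝕜 0) (FreeAC.of 𝕜 1) := by
  have hmem : ∀ x y : Fin 2, (∀ i, letterCount i (.of x * .of y : FreeMagma (Fin 2)) = 1) →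
      (.of x * .of y : FreeMagma (Fin 2)) ∈
        ({.of 0 * .of 1, .of 1 * .of 0} : Finset (FreeMagma (Fin 2))) := by decide
  have h := eq_sum_treeCoeff_smul Ψ {.of 0 * .of 1, .of 1 * .of 0} fun t ht => by
    obtain ⟨x, y, rfl⟩ := FreeMagma.exists_of_length_eq_two (hJ.length_eq_card ht)
    exact hmem x y (hJ.letterCount_eq_one ht)
  rw [Finset.sum_insert (by decide), Finset.sum_singleton, treeCoeff_mul_swap (.of 1)] at h
  have h1 : ∀ x y : Fin 2, halfWord 𝕜 (.of x * .of y) =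
      (2⁻¹ : 𝕜) • br 𝕜 (FreeAC.of 𝕜 x) (FreeAC.of 𝕜 y) := fun _ _ => rfl
  rw [h1, h1, br_anticomm (FreeAC.of 𝕜 1)] at h
  generalize treeCoeff (.of 0 * .of 1) Ψ = k at h ⊢
  rw [h]
  module

theorem IsJacobian.eq_smul_jacobian {Ψ : FreeAC 𝕜 (Fin 3)} (hJ : IsJacobian Ψ) :
    Ψ = (-treeCoeff (.of 0 * (.of 1 * .of 2)) Ψ) •
      jacobian 𝕜 (FreeAC.of 𝕜 0) (FreeAC.of 𝕜 1) (FreeAC.of 𝕜 2) := by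
  let T : Fin 3 → Fin 3 → Fin 3 → FreeMagma (Fin 3) := fun x y z => .of x * (.of y * .of z)
  let T' : Fin 3 → Fin 3 → Fin 3 → FreeMagma (Fin 3) := fun x y z => (.of x * .of y) * .of z
  -- All polylinear trees on three letters: six labellings of each of the two shapes.
  let s : Finset (FreeMagma (Fin 3)) :=
    {T 0 1 2, T 0 2 1, T 1 2 0, T 1 0 2, T 2 0 1, T 2 1 0,
      T' 0 1 2, T' 0 2 1, T' 1 2 0, T' 1 0 2, T' 2 0 1, T' 2 1 0}
  have hmem : ∀ x y z : Fin 3, ((∀ i, letterCount i (T x y z) = 1) → T x y z ∈ s) ∧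
      ((∀ i, letterCount i (T' x y z) = 1) → T' x y z ∈ s) := by decide
  have h := eq_sum_treeCoeff_smul Ψ s fun t ht => by
    obtain ⟨x, y, z, rfl | rfl⟩ := FreeMagma.exists_of_length_eq_three (hJ.length_eq_card ht)
    · exact (hmem x y z).1 (hJ.letterCount_eq_one ht)
    · exact (hmem x y z).2 (hJ.letterCount_eq_one ht)
  have hT' : ∀ x y z, treeCoeff (T' x y z) Ψ = -treeCoeff (T z x y) Ψ := fun x y z =>
    treeCoeff_mul_swap _ _ Ψ
  have h23 : ∀ x y z, treeCoeff (T x z y) Ψ = -treeCoeff (T x y z) Ψ := fun x y z =>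
    treeCoeff_spine_swap [.of x] _ _ Ψ
  have h12 : ∀ x y z, treeCoeff (T y x z) Ψ = -treeCoeff (T x y z) Ψ := fun x y z => by
    -- Two one-letter words have just two shuffles, so primitivity is antisymmetry here.
    have h1 := hJ.isPrimitive z [.of y] [.of x] (by simp) (by simp)
    rw [shuffleSum_cons_cons, shuffleSum_nil_left, shuffleSum_nil_right] at h1
    exact eq_neg_of_add_eq_zero_left h1
  have hw : ∀ x y z, halfWord 𝕜 (T x y z) =
      -((4⁻¹ : 𝕜) • br 𝕜 (br 𝕜 (FreeAC.of 𝕜 y) (FreeAC.of 𝕜 z)) (FreeAC.of 𝕜 x)) := fun x y z => by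
    change (2⁻¹ : 𝕜) • br 𝕜 (FreeAC.of 𝕜 x)
      ((2⁻¹ : 𝕜) • br 𝕜 (FreeAC.of 𝕜 y) (FreeAC.of 𝕜 z)) = _
    rw [br_smul_right, br_anticomm, smul_smul, smul_neg]
    norm_num
  have hw' : ∀ x y z, halfWord 𝕜 (T' x y z) =
      (4⁻¹ : 𝕜) • br 𝕜 (br 𝕜 (FreeAC.of 𝕜 x) (FreeAC.of 𝕜 y)) (FreeAC.of 𝕜 z) := fun x y z => by
    change (2⁻¹ : 𝕜) • br 𝕜 ((2⁻¹ : 𝕜) • br 𝕜 (FreeAC.of 𝕜 x) (FreeAC.of 𝕜 y))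
      (FreeAC.of 𝕜 z) = _
    rw [br_smul_left, smul_smul]
    norm_num
  have hbr : ∀ x y z : Fin 3, br 𝕜 (br 𝕜 (FreeAC.of 𝕜 y) (FreeAC.of 𝕜 x)) (FreeAC.of 𝕜 z) =
      -br 𝕜 (br 𝕜 (FreeAC.of 𝕜 x) (FreeAC.of 𝕜 y)) (FreeAC.of 𝕜 z) := fun x y z => by
    rw [br_anticomm (FreeAC.of 𝕜 y), ← neg_one_smul 𝕜, br_smul_left, neg_one_smul]
  have e1 : treeCoeff (T 1 2 0) Ψ = treeCoeff (T 0 1 2) Ψ := by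
    rw [h23 1 0 2, h12 0 1 2, neg_neg]
  have e2 : treeCoeff (T 2 0 1) Ψ = treeCoeff (T 0 1 2) Ψ := by
    rw [h12 0 2 1, h23 0 1 2, neg_neg]
  rw [show (.of 0 * (.of 1 * .of 2) : FreeMagma (Fin 3)) = T 0 1 2 from rfl]
  simp only [s] at h
  rw [Finset.sum_insert (by decide), Finset.sum_insert (by decide), Finset.sum_insert (by decide),
    Finset.sum_insert (by decide), Finset.sum_insert (by decide), Finset.sum_insert (by decide),
    Finset.sum_insert (by decide), Finset.sum_insert (by decide), Finset.sum_insert (by decide),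
    Finset.sum_insert (by decide), Finset.sum_insert (by decide), Finset.sum_singleton] at h
  simp only [hT', hw, hw'] at h
  rw [h23 0 1 2, h12 0 1 2, h23 2 0 1, e1, e2, hbr 1 2 0, hbr 0 2 1, hbr 0 1 2] at h
  rw [hbr 2 0 1] at h
  generalize treeCoeff (T 0 1 2) Ψ = k at h ⊢
  -- Each double bracket of `jacobian` arises from four of the twelve trees, each contributing -k/4.
  rw [h, jacobian]
  module

end FreeAC

/-! ### The classification -/

theorem mainTheorem2 {𝕜 : Type*} [Field 𝕜] [CharZero 𝕜] (n : ℕ) (Ψ : FreeAC 𝕜 (Fin n))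
    (hΨ : Ψ ≠ 0) (hJ : FreeAC.IsJacobian Ψ) :
    (∃ h : n = 2, ∃ α : 𝕜, α ≠ 0 ∧
      Ψ = α • br 𝕜 (FreeAC.of 𝕜 (Fin.cast h.symm 0)) (FreeAC.of 𝕜 (Fin.cast h.symm 1))) ∨
    (∃ h : n = 3, ∃ α : 𝕜, α ≠ 0 ∧
      Ψ = α • jacobian 𝕜 (FreeAC.of 𝕜 (Fin.cast h.symm 0)) (FreeAC.of 𝕜 (Fin.cast h.symm 1))
        (FreeAC.of 𝕜 (Fin.cast h.symm 2))) := by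
  have hne : ∃ t, FreeAC.treeCoeff t Ψ ≠ 0 := by
    by_contra! h
    exact hΨ ((FreeAC.eq_sum_treeCoeff_smul Ψ ∅ fun t ht => absurd (h t) ht).trans Finset.sum_empty)
  obtain ⟨t, ht⟩ := hne
  rcases lt_or_ge n 4 with hn | hn
  · interval_cases n
    -- For n = 0 a tree with nonzero coefficient would have no leaves.
    · exact absurd (hJ.length_eq_card ht) t.length_pos.ne'
    · exact absurd (hJ.eq_zero_of_one) hΨ
    · exact Or.inl ⟨rfl, _, fun h => hΨ (by rw [hJ.eq_smul_br, h, zero_smul]),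
        hJ.eq_smul_br⟩
    · exact Or.inr ⟨rfl, _, fun h => hΨ (by rw [hJ.eq_smul_jacobian, h, zero_smul]),
        hJ.eq_smul_jacobian⟩
  · exact absurd (FreeMagma.apply_eq_zero
      (fun u p q => FreeAC.treeCoeff_spine_swap u p q Ψ) hJ.isPrimitive hn (fun t ht => by
        simpa using hJ.length_eq_card ht) t) ht
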